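/- Conventions. $X$ and $Y$ are complex Banach spaces, $R(\lambda,A)=(\lambda-A)^{-1}$ for $\lambda\in\rho(A)$, and $\widehat f(\xi)=\int_{\mathbb R}e^{-i\xi t}f(t)\,dt$. Let $\dot{\mathcal S}(\mathbb R;Y)$ be the space of $Y$-valued Schwartz functions $f$ on $\mathbb R$ with $\widehat f^{\,(k)}(0)=0$ for all $k\ge 0$. A map $m:\mathbb R\setminus\{0\}\to\mathcal L(Y,X)$ is *strongly measurable* if $\xi\mapsto m(\xi)y$ is strongly measurable (for Lebesgue measure) for all $y\in Y$, and *of moderate growth* if there are $a\ge 0$ and $g\in L^1(\mathbb R)$ with $|\xi|^{a}(1+|\xi|)^{-2a}\|m(\xi)\|\le g(\xi)$ for all $\xi\ne 0$. For such $m$ put $T_m f=\mathcal F^{-1}(m\widehat f\,)$ for $f\in\dot{\mathcal S}(\mathbb R;Y)$. For $1\le p,q\le\infty$, $\mathcal M_{p,q}(\mathbb R;\mathcal L(Y,X))$ is the set of strongly measurable $m$ of moderate growth for which there is a constant $C$ with $\|T_mf\|_{L^q(\mathbb R;X)}\le C\|f\|_{L^p(\mathbb R;Y)}$ for all $f\in\dot{\mathcal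 S}(\mathbb R;Y)$. Let $\alpha,\beta\in[0,\infty)$. An operator $A$ on $X$ has *resolvent growth* $(\alpha,\beta)$ if $-A$ generates a $C_0$-semigroup on $X$, every $\lambda\neq 0$ with $\operatorname{Re}\lambda\le 0$ belongs to $\rho(A)$, and the operators $\frac{\lambda^\alpha}{(1+\lambda)^{\alpha+\beta}}(\lambda+A)^{-1}$, for $\lambda\ne 0$ with $\operatorname{Re}\lambda\ge 0$, are uniformly bounded on $X$. Let $-A$ be the generator of a $C_0$-semigroup $(T(t))_{t\ge0}$ on $X$ and let $n\in\mathbb N_0=\{0,1,2,\dots\}$. A Banach space $Y$ continuously embedded in $X$ is *$(A,n)$-admissible* if (a) there is a constant $C_T\ge 0$ such that $T(t)Y\subseteq Y$ and $\|T(t)|_Y\|_{\mathcal L(Y)}\le C_T\|T(t)\|_{\mathcal L(X)}$ for all $t\ge 0$, and (b) there is a dense subspace $Y_0\subseteq Y$ such that $[t\mapsto t^nT(t)y]\in L^1([0,\infty);X)$ for all $y\in Y_0$. **Theorem.** Let $-A$ be the generator of a $C_0$-semigroup $(T(t))_{t\ge0}$ on a Banach space $X$, and assume that $A$ has resolvent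 growth $(\alpha,\beta)$ for some $\alpha,\beta\in[0,\infty)$. Let $n\in\mathbb N_0$ and let $Y$ be an $(A,n)$-admissible space. Then the following statements are equivalent: 1. $\sup_{t\ge0}\|t^nT(t)\|_{\mathcal L(Y,X)}<\infty$; 2. there exist $\psi\in C_c^\infty(\mathbb R)$, $p\in[1,\infty)$ and $q\in[p,\infty]$ such that $$\psi(\cdot)R(i\cdot,A)^k\in\mathcal M_{1,\infty}(\mathbb R;\mathcal L(Y,X)),\qquad (1-\psi(\cdot))R(i\cdot,A)^k\in\mathcal M_{p,q}(\mathbb R;\mathcal L(Y,X))$$ for all $k\in\{n-1,n,n+1\}$ with $k\ge 1$. Moreover, if (1) or (2) holds, then $R(i\cdot,A)^k\in\mathcal M_{p,q}(\mathbb R;\mathcal L(Y,X))$ in each of the following cases: - (i) $n\ge2$, $k\in\{1,\dots,n-1\}$ and $1\le p\le q\le\infty$; - (ii) $k=n\ge1$ and $1\le p<q\le\infty$; - (iii) $k=n+1$, $p=1$ and $q=\infty$. -/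

import Mathlib

open MeasureTheory Filter Topology Set
open scoped SchwartzMap ENNReal NNReal

noncomputable section

namespace PolyStab

/-! ### Semigroups, generators, resolvents -/

section Semigroup

variable {X : Type*} [NormedAddCommGroup X] [NormedSpace ℂ X]

/-- `(T(t))_{t ≥ 0}` is a `C₀`-semigroup of bounded operators on `X`. Only the values `T t` with
`0 ≤ t` are meaningful. -/
structure IsC0Semigroup (T : ℝ → X →L[ℂ] X) : Prop where
  map_zero : T 0 = ContinuousLinearMap.id ℂ X
  map_add : ∀ s t : ℝ, 0 ≤ s → 0 ≤ t → T (s + t) = (T s).comp (T t)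
  tendsto_zero : ∀ x : X, Tendsto (fun t : ℝ => T t x) (𝓝[>] 0) (𝓝 x)

/-- The (in general unbounded) operator `B` is the generator of `(T(t))_{t ≥ 0}`: the domain of `B`
consists of all `x` for which `lim_{t ↓ 0} (T(t)x - x)/t` exists, and `B x` is that limit. -/
def IsGenerator (B : X →ₗ.[ℂ] X) (T : ℝ → X →L[ℂ] X) : Prop :=
  ∀ x y : X, (x, y) ∈ B.graph ↔
    Tendsto (fun t : ℝ => t⁻¹ • (T t x - x)) (𝓝[>] 0) (𝓝 y)

/-- The bounded operator `R` on `X` is a two-sided inverse of `z - A : D(A) → X`. -/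
def IsResolventAt (A : X →ₗ.[ℂ] X) (z : ℂ) (R : X →L[ℂ] X) : Prop :=
  (∀ x : X, ∃ h : R x ∈ A.domain, z • R x - A ⟨R x, h⟩ = x) ∧
    ∀ x : A.domain, R (z • (x : X) - A x) = x

/-- The resolvent set `ρ(A)` of an unbounded operator. -/
def opResolventSet (A : X →ₗ.[ℂ] X) : Set ℂ :=
  {z | ∃ R : X →L[ℂ] X, IsResolventAt A z R}

open Classical in
/-- The resolvent `R(z, A) = (z - A)⁻¹` for `z ∈ ρ(A)` (with the value `0` for `z ∉ ρ(A)`). -/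
def opResolvent (A : X →ₗ.[ℂ] X) (z : ℂ) : X →L[ℂ] X :=
  if h : z ∈ opResolventSet A then h.choose else 0

/-- A bounded inverse of `z - A` is unique, so it is the value of `opResolvent`. -/
theorem IsResolventAt.opResolvent_eq {A : X →ₗ.[ℂ] X} {z : ℂ} {R : X →L[ℂ] X}
    (hR : IsResolventAt A z R) : opResolvent A z = R := by
  have hz : z ∈ opResolventSet A := ⟨R, hR⟩
  have hS : IsResolventAt A z (opResolvent A z) := by
    rw [opResolvent, dif_pos hz]
    exact hz.choose_spec
  ext x
  obtain ⟨h, hx⟩ := hR.1 x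
  have h2 := hS.2 ⟨R x, h⟩
  rw [← hx]
  simpa [hx] using h2

/-- `A` has resolvent growth `(α, β)`: `-A` generates a `C₀`-semigroup, the closed left half-plane
without the origin is contained in `ρ(A)`, and the operators
`λ^α (1 + λ)^(-α-β) (λ + A)⁻¹`, for `λ ≠ 0` in the closed right half-plane, are uniformly bounded.
Here `(λ + A)⁻¹ = -R(-λ, A)`. -/
structure HasResolventGrowth (A : X →ₗ.[ℂ] X) (α β : ℝ) : Prop where
  generates : ∃ T : ℝ → X →L[ℂ] X, IsC0Semigroup T ∧ IsGenerator (-A) T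
  mem_resolventSet : ∀ z : ℂ, z.re ≤ 0 → z ≠ 0 → z ∈ opResolventSet A
  bounded : ∃ C : ℝ, ∀ z : ℂ, 0 ≤ z.re → z ≠ 0 →
    ‖(z ^ (α : ℂ) / (1 + z) ^ ((α + β : ℝ) : ℂ)) • (-opResolvent A (-z))‖ ≤ C

variable {Y : Type*} [NormedAddCommGroup Y] [NormedSpace ℂ Y]

/-- The space `Y`, continuously embedded in `X` through the injective bounded operator `ι`, is
`(A, n)`-admissible, where `-A` is the generator of `(T(t))_{t ≥ 0}`. In `invariant`, `z` is
`T(t) y`, viewed as an element of `Y`. -/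
structure IsAdmissible (T : ℝ → X →L[ℂ] X) (n : ℕ) (ι : Y →L[ℂ] X) : Prop where
  injective : Function.Injective ι
  invariant : ∃ C : ℝ, 0 ≤ C ∧ ∀ t : ℝ, 0 ≤ t → ∀ y : Y,
    ∃ z : Y, ι z = T t (ι y) ∧ ‖z‖ ≤ C * ‖T t‖ * ‖y‖
  dense : ∃ Y₀ : Submodule ℂ Y, Dense (Y₀ : Set Y) ∧
    ∀ y ∈ Y₀, IntegrableOn (fun t : ℝ => t ^ n • T t (ι y)) (Ici 0) volume

end Semigroup

/-! ### Operator-valued Fourier multipliers -/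

section Multiplier

variable {E F : Type*} [NormedAddCommGroup E] [NormedSpace ℂ E]
  [NormedAddCommGroup F] [NormedSpace ℂ F]

/-- The Fourier transform `f̂(ξ) = ∫ e^{-iξt} f(t) dt`. -/
def fourierHat (f : ℝ → E) (ξ : ℝ) : E :=
  ∫ t : ℝ, Complex.exp (-(Complex.I * ξ * t)) • f t

/-- The Schwartz functions whose Fourier transform vanishes to infinite order at `0`. -/
def homSchwartz (E : Type*) [NormedAddCommGroup E] [NormedSpace ℂ E] : Set (𝓢(ℝ, E)) :=
  {f | ∀ k : ℕ, iteratedDeriv k (fourierHat (f : ℝ → E)) 0 = 0}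

/-- The symbol `m : ℝ ∖ {0} → L(E, F)` is of moderate growth (the value of `m` at `0` is
irrelevant). -/
def ModerateGrowth (m : ℝ → E →L[ℂ] F) : Prop :=
  ∃ a : ℝ, 0 ≤ a ∧ ∃ g : ℝ → ℝ, Integrable g volume ∧
    ∀ ξ : ℝ, ξ ≠ 0 → |ξ| ^ a * (1 + |ξ|) ^ (-(2 * a)) * ‖m ξ‖ ≤ g ξ

/-- The Fourier multiplier operator `T_m f = ℱ⁻¹(m f̂)`. For `f ∈ homSchwartz E` and a strongly
measurable symbol `m` of moderate growth, `m f̂` is integrable, so that the inverse Fourier transform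
is given by an absolutely convergent integral. -/
def multiplierOp (m : ℝ → E →L[ℂ] F) (f : 𝓢(ℝ, E)) (t : ℝ) : F :=
  (1 / (2 * Real.pi) : ℝ) •
    ∫ ξ : ℝ, Complex.exp (Complex.I * ξ * t) • m ξ (fourierHat (f : ℝ → E) ξ)

/-- `m ∈ ℳ_{p,q}(ℝ; L(E, F))`: the symbol `m` is strongly measurable (symbols are identified when
equal almost everywhere) and of moderate growth, and `T_m` is bounded from `L^p(ℝ; E)` to
`L^q(ℝ; F)`, i.e. `‖T_m f‖_q ≤ C ‖f‖_p` for all `f` in the domain `homSchwartz E` of `T_m`. -/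
structure IsFourierMultiplier (p q : ℝ≥0∞) (m : ℝ → E →L[ℂ] F) : Prop where
  stronglyMeasurable : ∀ x : E, AEStronglyMeasurable (fun ξ : ℝ => m ξ x) volume
  moderateGrowth : ModerateGrowth m
  bounded : ∃ C : ℝ≥0, ∀ f ∈ homSchwartz E,
    eLpNorm (multiplierOp m f) q volume ≤ C * eLpNorm (f : ℝ → E) p volume

end Multiplier

section Symbols

variable {X : Type*} [NormedAddCommGroup X] [NormedSpace ℂ X]
  {Y : Type*} [NormedAddCommGroup Y] [NormedSpace ℂ Y]

/-- The symbol `ξ ↦ R(iξ, A)^k`, with values in `L(Y, X)`. -/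
def resolventPow (A : X →ₗ.[ℂ] X) (ι : Y →L[ℂ] X) (k : ℕ) (ξ : ℝ) : Y →L[ℂ] X :=
  (opResolvent A (Complex.I * ξ) ^ k).comp ι

/-- `sup_{t ≥ 0} ‖tⁿ T(t)‖_{L(Y, X)} < ∞`. -/
def PolynomiallyStable (T : ℝ → X →L[ℂ] X) (n : ℕ) (ι : Y →L[ℂ] X) : Prop :=
  BddAbove ((fun t : ℝ => ‖((t : ℂ) ^ n) • (T t).comp ι‖) '' Ici 0)

/-- There are `ψ ∈ C_c^∞(ℝ)`, `p ∈ [1, ∞)` and `q ∈ [p, ∞]` such that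
`ψ R(i·, A)^k ∈ ℳ_{1,∞}` and `(1 - ψ) R(i·, A)^k ∈ ℳ_{p,q}` for all positive integers
`k ∈ {n - 1, n, n + 1}`. -/
def ResolventMultipliers (A : X →ₗ.[ℂ] X) (n : ℕ) (ι : Y →L[ℂ] X) : Prop :=
  ∃ ψ : ℝ → ℂ, ContDiff ℝ (⊤ : ℕ∞) ψ ∧ HasCompactSupport ψ ∧
    ∃ p q : ℝ≥0∞, 1 ≤ p ∧ p < ∞ ∧ p ≤ q ∧
      ∀ k : ℕ, 1 ≤ k → n ≤ k + 1 → k ≤ n + 1 →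
        IsFourierMultiplier 1 ∞ (fun ξ => ψ ξ • resolventPow A ι k ξ) ∧
        IsFourierMultiplier p q (fun ξ => (1 - ψ ξ) • resolventPow A ι k ξ)

end Symbols

end PolyStab

end

open PolyStab

/-! Powers of the resolvent are Laplace transforms of weighted orbits: formally, `R(iξ,A)^k = (-1)^k
/ (k-1)! · ∫_0^∞ s^(k-1) e^(iξs) T(s) ds`. Hence the multiplier with this symbol is, up to a
constant, `f ↦ ∫_0^∞ s^(k-1) T(s) f(t+s) ds`, and the theorem compares the size of the kernel
`s^(k-1) T(s)` with the mapping properties of this operator.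

From stability to multipliers: local boundedness and stability bound the kernel in `L(Y,X)` by `K
(1+s)^(-(n+1-k))` (`PolynomiallyStable.exists_weighted_bound`). This is bounded for `k = n+1`, in
`L^r` for every `r > 1` when `k = n`, and in `L^1` for `k < n`, so Young's inequality gives exactly
the three cases. The integral need not converge absolutely on the imaginary axis, so
`enorm_multiplierOp_resolventPow_le` works with `R(iξ-ε,A)`, whose kernel carries an extra
`e^(-εs)`, and lets `ε ↓ 0`. Resolvent growth together with the infinite-order zero of the
transformed test function at `0` justifies dominated convergence.

From multipliers to stability: only `k = n+1` is needed. For `y` in the dense subspace the Laplace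
formula holds on the imaginary axis itself. A test function that follows the orbit of `y` backwards
over a unit interval is sent, at `-τ`, to approximately a constant times `τ^n T(τ)y`, while its
`L^1` and `L^∞` norms, hence all its `L^p` norms, are at most a constant times the norm of `y`
(`exists_test_function`). The two cut-off parts of the multiplier have different target spaces, but
both control an average over a unit interval (`exists_le_of_cutoff_multipliers`). This bounds `t^n
T(t)y`, and density finishes the argument. -/

noncomputable section

namespace PolyStab

/-! ### Local boundedness and joint continuity of C₀-semigroups. -/

section SemigroupTheory

variable {X : Type*} [NormedAddCommGroup X] [NormedSpace ℂ X] [CompleteSpace X]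

namespace IsC0Semigroup

variable {T : ℝ → X →L[ℂ] X}

omit [CompleteSpace X] in
theorem map_nsmul (hT : IsC0Semigroup T) {t : ℝ} (ht : 0 ≤ t) (m : ℕ) :
    T (m * t) = T t ^ m := by
  induction m with
  | zero => simp [hT.map_zero]; rfl
  | succ m ih =>
    have : ((m + 1 : ℕ) : ℝ) * t = m * t + t := by push_cast; ring
    rw [this, hT.map_add _ _ (by positivity) ht, ih, pow_succ]
    rfl

/-- Otherwise there are times `t m → 0` with `‖T (t m)‖ > m`. Every orbit converges along them and
so stays bounded, which contradicts the uniform boundedness principle. -/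
theorem exists_bound_near_zero (hT : IsC0Semigroup T) :
    ∃ δ > 0, ∃ M : ℝ, 1 ≤ M ∧ ∀ t ∈ Icc 0 δ, ‖T t‖ ≤ M := by
  have key : ∃ m : ℕ, ∀ t ∈ Ioo (0 : ℝ) (1 / ((m : ℝ) + 1)), ‖T t‖ ≤ m := by
    by_contra! H
    choose t ht hlt using H
    have ht0 : Tendsto t atTop (𝓝[>] 0) := by
      refine tendsto_nhdsWithin_iff.2 ⟨?_, Eventually.of_forall fun m => (ht m).1⟩
      exact squeeze_zero (fun m => (ht m).1.le) (fun m => (ht m).2.le)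
        tendsto_one_div_add_atTop_nhds_zero_nat
    obtain ⟨C, hC⟩ := banach_steinhaus (g := fun m => T (t m)) fun x => by
      obtain ⟨C, hC⟩ := ((hT.tendsto_zero x).comp ht0).norm.bddAbove_range
      exact ⟨C, fun m => hC ⟨m, rfl⟩⟩
    obtain ⟨m, hm⟩ := exists_nat_gt C
    exact absurd (hC m) (not_le.2 (hm.trans (hlt m)))
  obtain ⟨m, hm⟩ := key
  refine ⟨1 / ((m : ℝ) + 1) / 2, by positivity, max (m : ℝ) 1, le_max_right _ _, fun t ht => ?_⟩
  rcases ht.1.eq_or_lt with h | h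
  · rw [← h, hT.map_zero]
    exact ContinuousLinearMap.norm_id_le.trans (le_max_right _ _)
  · have : 0 < 1 / ((m : ℝ) + 1) := by positivity
    exact (hm t ⟨h, by linarith [ht.2]⟩).trans (le_max_left _ _)

theorem exists_bound (hT : IsC0Semigroup T) (a : ℝ) :
    ∃ M : ℝ, 1 ≤ M ∧ ∀ t ∈ Icc 0 a, ‖T t‖ ≤ M := by
  obtain ⟨δ, hδ, M, hM, hb⟩ := hT.exists_bound_near_zero
  obtain ⟨m, hm⟩ := exists_nat_gt (a / δ)
  refine ⟨M ^ (m + 1), one_le_pow₀ hM, fun t ht => ?_⟩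
  have h1 : T t = T (t / (m + 1 : ℕ)) ^ (m + 1) := by
    rw [← hT.map_nsmul (by have := ht.1; positivity)]
    congr 1
    field_simp
  rw [h1]
  refine (norm_pow_le' _ (Nat.succ_pos m)).trans ?_
  refine pow_le_pow_left₀ (norm_nonneg _) (hb _ ⟨by have := ht.1; positivity, ?_⟩) _
  rw [div_lt_iff₀ hδ] at hm
  rw [div_le_iff₀ (by positivity)]
  push_cast
  nlinarith [ht.2]

/-- Factoring out the operator at the earlier of two times reduces continuity from both sides to the
limit at `0`, by local boundedness. Since `T` is meaningless at negative times, `max t 0` extends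
the orbit continuously to the line, which later supplies measurability. -/
theorem continuous_orbit (hT : IsC0Semigroup T) (x : X) :
    Continuous fun t : ℝ => T (max t 0) x := by
  rw [Metric.continuous_iff]
  intro b ε hε
  obtain ⟨M, hM, hb⟩ := hT.exists_bound (max b 0 + 1)
  have hM0 : 0 < M := by linarith
  have h0 := hT.tendsto_zero x
  rw [Metric.tendsto_nhdsWithin_nhds] at h0
  obtain ⟨δ, hδ, h⟩ := h0 (ε / M) (by positivity)
  refine ⟨min δ 1, by positivity, fun a ha => ?_⟩
  have hmax : |max a 0 - max b 0| < min δ 1 :=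
    (abs_max_sub_max_le_abs a b 0).trans_lt (by simpa [Real.dist_eq] using ha)
  have main : ∀ u v : ℝ, 0 ≤ u → u ≤ v → u ≤ max b 0 + 1 → v - u < δ →
      ‖T v x - T u x‖ < ε := by
    intro u v hu huv hu1 hvu
    rcases huv.eq_or_lt with rfl | huv'
    · simpa using hε
    have e : T v x - T u x = T u (T (v - u) x - x) := by
      rw [map_sub, ← ContinuousLinearMap.comp_apply, ← hT.map_add _ _ hu (by linarith)]
      congr 3; ring
    have := h (x := v - u) (by simpa using huv')
      (by rw [Real.dist_eq, sub_zero, abs_of_pos (by linarith)]; exact hvu)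
    rw [dist_eq_norm] at this
    calc ‖T v x - T u x‖ ≤ ‖T u‖ * ‖T (v - u) x - x‖ := e ▸ (T u).le_opNorm _
      _ ≤ M * ‖T (v - u) x - x‖ := by gcongr; exact hb u ⟨hu, hu1⟩
      _ < M * (ε / M) := by gcongr
      _ = ε := by field_simp
  have h1 := lt_min_iff.1 hmax
  have h2 := abs_lt.1 h1.1
  have h3 := abs_lt.1 h1.2
  rw [dist_eq_norm]
  rcases le_total (max a 0) (max b 0) with h4 | h4
  · rw [norm_sub_rev]
    exact main _ _ (le_max_right _ _) h4 (by linarith) (by linarith)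
  · exact main _ _ (le_max_right _ _) h4 (by linarith) (by linarith)

theorem continuous_uncurry (hT : IsC0Semigroup T) :
    Continuous fun p : ℝ × X => T (max p.1 0) p.2 := by
  rw [continuous_iff_continuousAt]
  rintro ⟨s, x⟩
  obtain ⟨M, hM, hb⟩ := hT.exists_bound (max s 0 + 1)
  have hev : ∀ᶠ p : ℝ × X in 𝓝 (s, x), ‖T (max p.1 0)‖ ≤ M := by
    have : Tendsto (fun p : ℝ × X => max p.1 0) (𝓝 (s, x)) (𝓝 (max s 0)) :=
      (continuous_fst.max continuous_const).tendsto _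
    filter_upwards [this.eventually (gt_mem_nhds (lt_add_one (max s 0)))] with p hp
    exact hb _ ⟨le_max_right _ _, hp.le⟩
  have h1 : Tendsto (fun p : ℝ × X => T (max p.1 0) (p.2 - x)) (𝓝 (s, x)) (𝓝 0) := by
    have h2 : Tendsto (fun p : ℝ × X => M * ‖p.2 - x‖) (𝓝 (s, x)) (𝓝 0) := by
      have : Continuous fun p : ℝ × X => M * ‖p.2 - x‖ := by fun_prop
      simpa using this.tendsto (s, x)
    refine squeeze_zero_norm' ?_ h2
    filter_upwards [hev] with p hp
    exact ((T _).le_opNorm _).trans (by gcongr)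
  have h3 : Tendsto (fun p : ℝ × X => T (max p.1 0) x) (𝓝 (s, x)) (𝓝 (T (max s 0) x)) :=
    ((hT.continuous_orbit x).comp continuous_fst).tendsto (s, x)
  simpa [ContinuousAt] using h1.add h3

end IsC0Semigroup

end SemigroupTheory

/-! ### Resolvent powers as Laplace transforms. -/

section LaplaceTransform

variable {X : Type*} [NormedAddCommGroup X] [NormedSpace ℂ X] [CompleteSpace X]
  {T : ℝ → X →L[ℂ] X}

omit [CompleteSpace X] in
/-- Translating a damped orbit of the semigroup. -/
theorem IsC0Semigroup.exp_smul_map_add (hT : IsC0Semigroup T) (z : ℂ) (x : X) {r s : ℝ}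
    (hr : 0 ≤ r) (hs : 0 ≤ s) :
    Complex.exp (-(z * s)) • T s (T r x) =
      Complex.exp (z * r) • (Complex.exp (-(z * (s + r : ℝ))) • T (s + r) x) := by
  rw [hT.map_add _ _ hs hr, smul_smul, ← Complex.exp_add]
  congr 2
  push_cast; ring

theorem integral_Ioi_add_right {E : Type*} [NormedAddCommGroup E] [NormedSpace ℝ E]
    (g : ℝ → E) (r : ℝ) : ∫ s in Ioi (0 : ℝ), g (s + r) = ∫ s in Ioi r, g s := by
  have h := (measurePreserving_add_right volume r).setIntegral_preimage_emb
    (MeasurableEquiv.addRight r).measurableEmbedding g (Ioi r)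
  rw [← h]
  simp

theorem IsC0Semigroup.integral_exp_smul_map (hT : IsC0Semigroup T) (z : ℂ) (x : X) {r : ℝ}
    (hr : 0 ≤ r) :
    ∫ s in Ioi (0 : ℝ), Complex.exp (-(z * s)) • T s (T r x) =
      Complex.exp (z * r) • ∫ s in Ioi r, Complex.exp (-(z * s)) • T s x := by
  rw [← integral_Ioi_add_right _ r, ← integral_smul]
  exact setIntegral_congr_fun measurableSet_Ioi fun s hs =>
    hT.exp_smul_map_add z x hr (mem_Ioi.1 hs).le

theorem IsC0Semigroup.integrableOn_exp_smul_map (hT : IsC0Semigroup T) {z : ℂ} {x : X}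
    (hx : IntegrableOn (fun s : ℝ => Complex.exp (-(z * s)) • T s x) (Ioi 0)) {r : ℝ}
    (hr : 0 ≤ r) :
    IntegrableOn (fun s : ℝ => Complex.exp (-(z * s)) • T s (T r x)) (Ioi 0) := by
  have h1 : IntegrableOn (fun s : ℝ => Complex.exp (-(z * (s + r : ℝ))) • T (s + r) x)
      (Ioi 0) := by
    have h := (measurePreserving_add_right volume r).integrableOn_comp_preimage
      (MeasurableEquiv.addRight r).measurableEmbedding
      (f := fun s : ℝ => Complex.exp (-(z * s)) • T s x) (s := Ioi r)
    have h2 := h.2 (hx.mono_set (Ioi_subset_Ioi hr))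
    simpa [Function.comp_def] using h2
  exact IntegrableOn.congr_fun (h1.smul (Complex.exp (z * r)))
    (fun s hs => (hT.exp_smul_map_add z x hr (mem_Ioi.1 hs).le).symm) measurableSet_Ioi

/-- The Laplace transform of an orbit is given by the resolvent. -/
theorem IsC0Semigroup.resolvent_eq_neg_laplace (hT : IsC0Semigroup T) {A : X →ₗ.[ℂ] X}
    (hA : IsGenerator (-A) T) {z : ℂ} {R : X →L[ℂ] X} (hR : IsResolventAt A (-z) R) {x : X}
    (hx : IntegrableOn (fun s : ℝ => Complex.exp (-(z * s)) • T s x) (Ioi 0)) :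
    R x = -∫ s in Ioi (0 : ℝ), Complex.exp (-(z * s)) • T s x := by
  set G : ℝ → X := fun s => Complex.exp (-(z * s)) • T (max s 0) x with hG
  have hGc : Continuous G := by
    have h : Continuous fun s : ℝ => Complex.exp (-(z * s)) := by fun_prop
    exact h.smul (hT.continuous_orbit x)
  have hGe : EqOn (fun s : ℝ => Complex.exp (-(z * s)) • T s x) G (Ioi 0) := fun s hs => by
    simp [hG, max_eq_left (mem_Ioi.1 hs).le]
  set u := ∫ s in Ioi (0 : ℝ), Complex.exp (-(z * s)) • T s x with hu
  have huG : u = ∫ s in Ioi (0 : ℝ), G s := setIntegral_congr_fun measurableSet_Ioi hGe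
  have hGi : IntegrableOn G (Ioi 0) := hx.congr_fun hGe measurableSet_Ioi
  -- The semigroup acts on the Laplace transform `u` by translating the integrand. The right side is
  -- differentiable at `h = 0` with derivative `z • u - x`, so `u` lies in the domain and `-A u = z
  -- • u - x`. Only integrability of the damped orbit enters, so `z` may be purely imaginary.
  have hTu : ∀ h : ℝ, 0 < h → T h u = Complex.exp (z * h) • (u - ∫ s in (0)..h, G s) := by
    intro h hh
    rw [← intervalIntegral.integral_Ioi_sub_Ioi hGi hh.le, huG, sub_sub_cancel]
    rw [← huG, hu, ← ContinuousLinearMap.integral_comp_comm _ hx]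
    have e : ∫ s in Ioi h, G s = ∫ s in Ioi h, Complex.exp (-(z * s)) • T s x :=
      setIntegral_congr_fun measurableSet_Ioi fun s hs => (hGe (hh.trans hs)).symm
    rw [e, ← hT.integral_exp_smul_map z x hh.le]
    refine setIntegral_congr_fun measurableSet_Ioi fun s hs => ?_
    simp only [map_smul]
    rw [← ContinuousLinearMap.comp_apply, ← ContinuousLinearMap.comp_apply,
      ← hT.map_add _ _ hh.le (mem_Ioi.1 hs).le, ← hT.map_add _ _ (mem_Ioi.1 hs).le hh.le, add_comm]
  have hder : HasDerivAt (fun h : ℝ => Complex.exp (z * h) • (u - ∫ s in (0)..h, G s))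
      (z • u - x) 0 := by
    have h1 : HasDerivAt (fun h : ℝ => Complex.exp (z * h)) z 0 := by
      have : HasDerivAt (fun h : ℝ => z * (h : ℂ)) z 0 := by
        simpa using (Complex.ofRealCLM.hasDerivAt (x := (0 : ℝ))).const_mul z
      simpa using this.cexp
    have h2 : HasDerivAt (fun h : ℝ => u - ∫ s in (0)..h, G s) (-(G 0)) 0 := by
      simpa using (intervalIntegral.integral_hasDerivAt_right (hGc.intervalIntegrable 0 0)
        (hGc.stronglyMeasurableAtFilter _ _) hGc.continuousAt).const_sub u
    have h0 : G 0 = x := by simp [hG, hT.map_zero]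
    refine (h1.smul h2).congr_deriv ?_
    simp [h0, sub_eq_neg_add]
  have hlim : Tendsto (fun t : ℝ => t⁻¹ • (T t u - u)) (𝓝[>] 0) (𝓝 (z • u - x)) := by
    have h4 := (hasDerivWithinAt_iff_tendsto_slope' (by simp)).1
      (hder.hasDerivWithinAt (s := Ioi 0))
    refine h4.congr' ?_
    filter_upwards [self_mem_nhdsWithin] with t ht
    rw [slope_def_module, hTu t ht]
    simp
  have hmem := (hA u (z • u - x)).2 hlim
  rw [LinearPMap.mem_graph_iff] at hmem
  obtain ⟨v, hv1, hv2⟩ := hmem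
  simp only at hv1 hv2
  have hAv : A v = x - z • u := by
    have : -(A v) = z • u - x := hv2
    rw [← neg_eq_iff_eq_neg.2 this.symm, neg_sub]
  have h5 := hR.2 v
  rw [hAv, hv1] at h5
  have : -z • u - (x - z • u) = -x := by rw [neg_smul]; abel
  rw [this, map_neg] at h5
  rw [← h5, neg_neg]

theorem integral_indicator_Iio_pow_smul {E : Type*} [NormedAddCommGroup E] [NormedSpace ℝ E]
    [CompleteSpace E] (j : ℕ) {r : ℝ} (hr : 0 < r) (c : E) :
    ∫ s in Ioi (0 : ℝ), (Iio r).indicator (fun s => s ^ j • c) s =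
      ((j : ℝ) + 1)⁻¹ • r ^ (j + 1) • c := by
  rw [setIntegral_indicator measurableSet_Iio, Ioi_inter_Iio, ← integral_Ioc_eq_integral_Ioo,
    ← intervalIntegral.integral_of_le hr.le, intervalIntegral.integral_smul_const, integral_pow,
    smul_smul]
  congr 1
  simp; ring

/-- Fubini's theorem on the triangle `0 < s < r`. -/
theorem integral_pow_smul_integral_Ioi {E : Type*} [NormedAddCommGroup E] [NormedSpace ℝ E]
    [CompleteSpace E] (j : ℕ) {g : ℝ → E} (hgm : AEStronglyMeasurable g (volume.restrict (Ioi 0)))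
    (hg : IntegrableOn (fun s : ℝ => s ^ (j + 1) • g s) (Ioi 0)) :
    ∫ s in Ioi (0 : ℝ), s ^ j • ∫ r in Ioi s, g r =
      ((j : ℝ) + 1)⁻¹ • ∫ r in Ioi (0 : ℝ), r ^ (j + 1) • g r := by
  set μ : Measure ℝ := volume.restrict (Ioi 0) with hμ
  set F : ℝ → ℝ → E := fun s r => (Iio r).indicator (fun s => s ^ j • g r) s with hF
  have hmeas : AEStronglyMeasurable (Function.uncurry F) (μ.prod μ) := by
    have h1 : AEStronglyMeasurable (fun p : ℝ × ℝ => p.1 ^ j • g p.2) (μ.prod μ) :=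
      (by fun_prop : Continuous fun p : ℝ × ℝ => p.1 ^ j).aestronglyMeasurable.smul hgm.comp_snd
    have h2 : MeasurableSet {p : ℝ × ℝ | p.1 < p.2} := measurableSet_lt measurable_fst measurable_snd
    refine (h1.indicator h2).congr (Eventually.of_forall fun p => ?_)
    simp [Function.uncurry, hF, indicator]
  have hint : Integrable (Function.uncurry F) (μ.prod μ) := by
    rw [integrable_prod_iff' hmeas]
    constructor
    · filter_upwards with r
      have h1 : IntegrableOn (fun s : ℝ => s ^ j • g r) (Ioo 0 r) :=
        ((by fun_prop : Continuous fun s : ℝ => s ^ j • g r).integrableOn_Icc).mono_set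
          Ioo_subset_Icc_self
      simp only [Function.uncurry, hF, hμ]
      rw [integrable_indicator_iff measurableSet_Iio, IntegrableOn,
        Measure.restrict_restrict measurableSet_Iio, inter_comm, Ioi_inter_Iio]
      exact h1
    · have h2 : Integrable (fun r : ℝ => ((j : ℝ) + 1)⁻¹ * ‖r ^ (j + 1) • g r‖) μ :=
        hg.norm.const_mul _
      refine h2.congr ?_
      filter_upwards [ae_restrict_mem measurableSet_Ioi] with r hr
      have h3 : ∫ s, ‖Function.uncurry F (s, r)‖ ∂μ =
          ∫ s in Ioi (0 : ℝ), (Iio r).indicator (fun s => s ^ j • ‖g r‖) s := by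
        refine setIntegral_congr_fun measurableSet_Ioi fun s hs => ?_
        simp only [Function.uncurry, hF, indicator]
        split_ifs
        · rw [norm_smul, norm_pow, Real.norm_eq_abs, abs_of_pos (mem_Ioi.1 hs), smul_eq_mul]
        · exact norm_zero
      rw [h3, integral_indicator_Iio_pow_smul j hr, norm_smul, norm_pow, Real.norm_eq_abs,
        abs_of_pos (mem_Ioi.1 hr)]
      simp
  calc ∫ s in Ioi (0 : ℝ), s ^ j • ∫ r in Ioi s, g r
      = ∫ s, ∫ r, F s r ∂μ ∂μ := by
        refine setIntegral_congr_fun measurableSet_Ioi fun s hs => ?_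
        have : ∀ r, F s r = (Ioi s).indicator (fun r => s ^ j • g r) r := fun r => by
          simp [hF, indicator]
        simp only [this, hμ]
        rw [setIntegral_indicator measurableSet_Ioi, Ioi_inter_Ioi, max_eq_right (mem_Ioi.1 hs).le,
          integral_smul]
    _ = ∫ r, ∫ s, F s r ∂μ ∂μ := integral_integral_swap hint
    _ = ∫ r in Ioi (0 : ℝ), ((j : ℝ) + 1)⁻¹ • r ^ (j + 1) • g r :=
        setIntegral_congr_fun measurableSet_Ioi fun r hr => integral_indicator_Iio_pow_smul j hr (g r)
    _ = _ := integral_smul _ _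

/-- Powers of the resolvent as Laplace transforms of weighted orbits. -/
theorem IsC0Semigroup.resolvent_pow_eq_laplace (hT : IsC0Semigroup T) {A : X →ₗ.[ℂ] X}
    (hA : IsGenerator (-A) T) {z : ℂ} {R : X →L[ℂ] X} (hR : IsResolventAt A (-z) R) {x : X}
    {n : ℕ} (hx : ∀ j ≤ n, IntegrableOn
      (fun s : ℝ => s ^ j • Complex.exp (-(z * s)) • T s x) (Ioi 0)) :
    ∀ j ≤ n, (R ^ (j + 1)) x = ((-1) ^ (j + 1) * (j.factorial : ℝ)⁻¹) •
      ∫ s in Ioi (0 : ℝ), s ^ j • Complex.exp (-(z * s)) • T s x := by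
  have h0 : IntegrableOn (fun s : ℝ => Complex.exp (-(z * s)) • T s x) (Ioi 0) := by
    simpa using hx 0 (Nat.zero_le _)
  intro j hj
  induction j with
  | zero => simpa using hT.resolvent_eq_neg_laplace hA hR h0
  | succ j ih =>
    rw [pow_succ', mul_apply_eq_comp, ih (by omega), ContinuousLinearMap.map_smul_of_tower,
      ← ContinuousLinearMap.integral_comp_comm _ (hx j (by omega))]
    -- One more resolvent turns the damped orbit at `s` into minus its tail integral beyond `s`.
    -- Fubini on the triangle then replaces `s ^ j` by `s ^ (j + 1) / (j + 1)`, which accounts for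
    -- the factorial.
    have h1 : ∀ s ∈ Ioi (0 : ℝ), R (s ^ j • Complex.exp (-(z * s)) • T s x) =
        -(s ^ j • ∫ r in Ioi s, Complex.exp (-(z * r)) • T r x) := by
      intro s hs
      have hs' : 0 ≤ s := (mem_Ioi.1 hs).le
      rw [ContinuousLinearMap.map_smul_of_tower, map_smul, hT.resolvent_eq_neg_laplace hA hR
        (hT.integrableOn_exp_smul_map h0 hs'), hT.integral_exp_smul_map z x hs', smul_neg,
        smul_neg, smul_smul (Complex.exp _), ← Complex.exp_add]
      simp
    rw [setIntegral_congr_fun measurableSet_Ioi h1, integral_neg,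
      integral_pow_smul_integral_Ioi j h0.aestronglyMeasurable (hx (j + 1) hj), ← smul_neg,
      smul_neg, ← neg_smul, smul_smul]
    congr 1
    rw [Nat.factorial_succ]
    push_cast
    have : (j.factorial : ℝ) ≠ 0 := by positivity
    have : (j : ℝ) + 1 ≠ 0 := by positivity
    field_simp
    ring

end LaplaceTransform

/-! ### Continuity and polynomial growth of the resolvent symbols. -/

section ResolventEstimates

variable {X : Type*} [NormedAddCommGroup X] [NormedSpace ℂ X] {A : X →ₗ.[ℂ] X}

theorem isResolventAt_opResolvent {z : ℂ} (hz : z ∈ opResolventSet A) :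
    IsResolventAt A z (opResolvent A z) := by
  rw [opResolvent, dif_pos hz]
  exact hz.choose_spec

theorem resolvent_identity {z w : ℂ} (hz : z ∈ opResolventSet A) (hw : w ∈ opResolventSet A) :
    opResolvent A z - opResolvent A w = (w - z) • (opResolvent A z * opResolvent A w) := by
  ext x
  obtain ⟨h, hx⟩ := (isResolventAt_opResolvent hw).1 x
  have h2 := (isResolventAt_opResolvent hz).2 ⟨_, h⟩
  simp only at h2
  have h3 : z • opResolvent A w x - A ⟨opResolvent A w x, h⟩ =
      x - (w - z) • opResolvent A w x := by
    have h4 : A ⟨opResolvent A w x, h⟩ = w • opResolvent A w x - x := by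
      exact (sub_eq_iff_eq_add.1 hx) |> fun e => by rw [e]; abel
    rw [h4, sub_smul]; abel
  rw [h3, map_sub, map_smul] at h2
  simp only [sub_apply, smul_apply, mul_apply_eq_comp]
  rw [sub_eq_iff_eq_add] at h2 ⊢
  exact h2.trans (add_comm _ _)

theorem continuousOn_opResolvent : ContinuousOn (opResolvent A) (opResolventSet A) := by
  intro w hw
  rw [ContinuousWithinAt, tendsto_iff_norm_sub_tendsto_zero]
  set K := ‖opResolvent A w‖ with hK
  have hbd : ∀ᶠ z in 𝓝[opResolventSet A] w,
      ‖opResolvent A z - opResolvent A w‖ ≤ ‖w - z‖ * (2 * K * K) := by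
    have h1 : Tendsto (fun z : ℂ => ‖w - z‖ * K) (𝓝[opResolventSet A] w) (𝓝 0) := by
      have : Continuous fun z : ℂ => ‖w - z‖ * K := by fun_prop
      simpa using (this.tendsto w).mono_left nhdsWithin_le_nhds
    filter_upwards [h1.eventually (gt_mem_nhds (by norm_num : (0 : ℝ) < 1 / 2)),
      self_mem_nhdsWithin] with z hz hzA
    have h2 : ‖opResolvent A z - opResolvent A w‖ ≤ ‖w - z‖ * (‖opResolvent A z‖ * K) := by
      rw [resolvent_identity hzA hw, norm_smul]
      gcongr
      exact norm_mul_le _ _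
    -- Absorption: `‖w - z‖ * K < 1/2`, so half of the unknown norm moves to the left side.
    have h3 : ‖opResolvent A z‖ ≤ 2 * K := by
      have h4 := norm_sub_norm_le (opResolvent A z) (opResolvent A w)
      have h5 : ‖w - z‖ * (‖opResolvent A z‖ * K) = ‖w - z‖ * K * ‖opResolvent A z‖ := by ring
      nlinarith [norm_nonneg (opResolvent A z)]
    exact h2.trans (by gcongr)
  refine squeeze_zero' (Eventually.of_forall fun _ => norm_nonneg _) hbd ?_
  have : Continuous fun z : ℂ => ‖w - z‖ * (2 * K * K) := by fun_prop
  simpa using (this.tendsto w).mono_left nhdsWithin_le_nhds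

/-- The growth hypothesis covers the whole closed half-plane, so the bound is uniform in the shift
`ε`, as dominated convergence will require. The real exponents are rounded up to naturals to be
matched against Schwartz seminorms. -/
theorem HasResolventGrowth.exists_norm_le {α β : ℝ} (hα : 0 ≤ α)
    (h : HasResolventGrowth A α β) :
    ∃ (C : ℝ) (a b : ℕ), 0 ≤ C ∧ ∀ ε ∈ Icc (0 : ℝ) 1, ∀ ξ : ℝ, ξ ≠ 0 →
      |ξ| ^ a * ‖opResolvent A (Complex.I * ξ - ε)‖ ≤ C * (1 + |ξ|) ^ b := by
  obtain ⟨C, hC⟩ := h.bounded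
  obtain ⟨a, ha⟩ := exists_nat_ge α
  obtain ⟨b, hb⟩ := exists_nat_ge (α + β)
  refine ⟨|C| * 2 ^ b, a, a + b, by positivity, fun ε hε ξ hξ => ?_⟩
  set z : ℂ := ε - Complex.I * ξ with hz
  have hre : z.re = ε := by simp [hz]
  have him : z.im = -ξ := by simp [hz]
  have hz0 : z ≠ 0 := fun h0 => hξ (by simpa [him] using congrArg Complex.im h0)
  have hξz : |ξ| ≤ ‖z‖ := by simpa [him] using Complex.abs_im_le_norm z
  have hzn : 0 < ‖z‖ := norm_pos_iff.2 hz0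
  have h1z : 1 ≤ ‖1 + z‖ := by
    have := Complex.re_le_norm (1 + z)
    simp [hre] at this
    linarith [hε.1]
  have h1z' : ‖1 + z‖ ≤ 2 * (1 + |ξ|) := by
    have h1 : ‖z‖ ≤ ε + |ξ| := by
      refine (norm_sub_le _ _).trans ?_
      simp [abs_of_nonneg hε.1]
    have h2 := norm_add_le (1 : ℂ) z
    rw [norm_one] at h2
    linarith [hε.2, abs_nonneg ξ]
  have hmain := hC z (by rw [hre]; exact hε.1) hz0
  have hzneg : -z = Complex.I * ξ - ε := by rw [hz]; ring
  rw [norm_smul, norm_neg, norm_div, Complex.norm_cpow_real, Complex.norm_cpow_real, hzneg] at hmain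
  set ρ := ‖opResolvent A (Complex.I * ξ - ε)‖ with hρ
  have hpos : 0 < ‖1 + z‖ ^ (α + β) := by positivity
  have hmain' : ‖z‖ ^ α * ρ ≤ |C| * ‖1 + z‖ ^ (α + β) := by
    rw [div_mul_eq_mul_div, div_le_iff₀ hpos] at hmain
    exact hmain.trans (by gcongr; exact le_abs_self C)
  have hup : ‖1 + z‖ ^ (α + β) ≤ (2 * (1 + |ξ|)) ^ b := by
    calc ‖1 + z‖ ^ (α + β) ≤ ‖1 + z‖ ^ (b : ℝ) := Real.rpow_le_rpow_of_exponent_le h1z hb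
      _ = ‖1 + z‖ ^ b := Real.rpow_natCast _ _
      _ ≤ _ := by gcongr
  -- Rounding `α` up to `a` is harmless for `‖z‖ ≤ 1`. For `‖z‖ ≥ 1` the factor `(1 + |ξ|) ^ a` pays
  -- for it.
  have hlow : |ξ| ^ a ≤ ‖z‖ ^ α * (1 + |ξ|) ^ a := by
    have h1 : (1 : ℝ) ≤ 1 + |ξ| := by linarith [abs_nonneg ξ]
    rcases le_total ‖z‖ 1 with h | h
    · calc |ξ| ^ a ≤ ‖z‖ ^ a := by gcongr
        _ = ‖z‖ ^ (a : ℝ) := (Real.rpow_natCast _ _).symm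
        _ ≤ ‖z‖ ^ α := Real.rpow_le_rpow_of_exponent_ge hzn h ha
        _ ≤ ‖z‖ ^ α * (1 + |ξ|) ^ a := le_mul_of_one_le_right (by positivity) (one_le_pow₀ h1)
    · calc |ξ| ^ a ≤ (1 + |ξ|) ^ a := by gcongr; linarith
        _ ≤ ‖z‖ ^ α * (1 + |ξ|) ^ a :=
          le_mul_of_one_le_left (by positivity) (Real.one_le_rpow h hα)
  calc |ξ| ^ a * ρ ≤ ‖z‖ ^ α * (1 + |ξ|) ^ a * ρ := by gcongr
    _ = ‖z‖ ^ α * ρ * (1 + |ξ|) ^ a := by ring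
    _ ≤ |C| * (2 * (1 + |ξ|)) ^ b * (1 + |ξ|) ^ a := by
      exact mul_le_mul_of_nonneg_right (hmain'.trans (by gcongr)) (by positivity)
    _ = |C| * 2 ^ b * (1 + |ξ|) ^ (a + b) := by rw [mul_pow, pow_add]; ring

variable {Y : Type*} [NormedAddCommGroup Y] [NormedSpace ℂ Y]

/-- The symbol `ξ ↦ R(iξ - ε, A)^k` with values in `L(Y, X)`. -/
def shiftedResolventPow (A : X →ₗ.[ℂ] X) (ι : Y →L[ℂ] X) (k : ℕ) (ε ξ : ℝ) : Y →L[ℂ] X :=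
  (opResolvent A (Complex.I * ξ - ε) ^ k).comp ι

theorem shiftedResolventPow_zero (ι : Y →L[ℂ] X) (k : ℕ) :
    shiftedResolventPow A ι k 0 = resolventPow A ι k := by
  ext ξ; simp [shiftedResolventPow, resolventPow]

theorem HasResolventGrowth.mem_opResolventSet {α β : ℝ} (h : HasResolventGrowth A α β) {ε ξ : ℝ}
    (hε : 0 ≤ ε) (hξ : ξ ≠ 0) : Complex.I * ξ - ε ∈ opResolventSet A := by
  refine h.mem_resolventSet _ (by simpa using hε) fun h0 => hξ ?_
  simpa using congrArg Complex.im h0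

theorem HasResolventGrowth.exists_norm_shiftedResolventPow_le {α β : ℝ} (hα : 0 ≤ α)
    (h : HasResolventGrowth A α β) (ι : Y →L[ℂ] X) {k : ℕ} (hk : 1 ≤ k) :
    ∃ (C : ℝ) (a b : ℕ), 0 ≤ C ∧ ∀ ε ∈ Icc (0 : ℝ) 1, ∀ ξ : ℝ, ξ ≠ 0 →
      |ξ| ^ a * ‖shiftedResolventPow A ι k ε ξ‖ ≤ C * (1 + |ξ|) ^ b := by
  obtain ⟨C, a, b, hC, hb⟩ := h.exists_norm_le hα
  refine ⟨C ^ k * ‖ι‖, a * k, b * k, by positivity, fun ε hε ξ hξ => ?_⟩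
  calc |ξ| ^ (a * k) * ‖shiftedResolventPow A ι k ε ξ‖
      ≤ |ξ| ^ (a * k) * (‖opResolvent A (Complex.I * ξ - ε)‖ ^ k * ‖ι‖) := by
        gcongr
        exact (ContinuousLinearMap.opNorm_comp_le _ _).trans
          (by gcongr; exact norm_pow_le' _ hk)
    _ = (|ξ| ^ a * ‖opResolvent A (Complex.I * ξ - ε)‖) ^ k * ‖ι‖ := by
        rw [mul_pow, pow_mul]; ring
    _ ≤ (C * (1 + |ξ|) ^ b) ^ k * ‖ι‖ := mul_le_mul_of_nonneg_right
        (pow_le_pow_left₀ (by positivity) (hb ε hε ξ hξ) k) (norm_nonneg ι)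
    _ = C ^ k * ‖ι‖ * (1 + |ξ|) ^ (b * k) := by rw [mul_pow, pow_mul]; ring

theorem HasResolventGrowth.continuousOn_shiftedResolventPow {α β : ℝ}
    (h : HasResolventGrowth A α β) (ι : Y →L[ℂ] X) (k : ℕ) {ε : ℝ} (hε : 0 ≤ ε) :
    ContinuousOn (shiftedResolventPow A ι k ε) {0}ᶜ := by
  have h1 : ContinuousOn (fun ξ : ℝ => opResolvent A (Complex.I * ξ - ε)) {0}ᶜ :=
    continuousOn_opResolvent.comp (by fun_prop) fun ξ hξ => h.mem_opResolventSet hε hξ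
  exact (h1.pow k).clm_comp continuousOn_const

theorem HasResolventGrowth.tendsto_shiftedResolventPow {α β : ℝ}
    (h : HasResolventGrowth A α β) (ι : Y →L[ℂ] X) (k : ℕ) {ξ : ℝ} (hξ : ξ ≠ 0) :
    Tendsto (fun ε => shiftedResolventPow A ι k ε ξ) (𝓝[>] 0) (𝓝 (resolventPow A ι k ξ)) := by
  have h1 : ContinuousOn (fun ε : ℝ => opResolvent A (Complex.I * ξ - ε)) (Ici 0) :=
    continuousOn_opResolvent.comp (by fun_prop) fun ε hε => h.mem_opResolventSet hε hξ
  have h2 : ContinuousOn (fun ε => shiftedResolventPow A ι k ε ξ) (Ici 0) :=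
    (h1.pow k).clm_comp continuousOn_const
  rw [← shiftedResolventPow_zero]
  exact (h2 0 self_mem_Ici).mono_left (nhdsWithin_mono _ Ioi_subset_Ici_self)

theorem aestronglyMeasurable_of_continuousOn_compl_zero {E : Type*} [NormedAddCommGroup E]
    {g : ℝ → E} (hg : ContinuousOn g {0}ᶜ) : AEStronglyMeasurable g volume := by
  have := hg.aestronglyMeasurable (μ := volume) (measurableSet_singleton (0 : ℝ)).compl
  rwa [Measure.restrict_eq_self_of_ae_mem] at this
  simp [ae_iff]

theorem moderateGrowth_of_polynomial_bound {m : ℝ → Y →L[ℂ] X} {C : ℝ} {a b : ℕ}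
    (hm : ∀ ξ : ℝ, ξ ≠ 0 → |ξ| ^ a * ‖m ξ‖ ≤ C * (1 + |ξ|) ^ b) : ModerateGrowth m := by
  have hC : 0 ≤ C := by
    have := hm 1 one_ne_zero
    have h2 : 0 ≤ C * (1 + |(1 : ℝ)|) ^ b := le_trans (by positivity) this
    exact nonneg_of_mul_nonneg_left h2 (by positivity)
  -- Of the exponent, `a` cancels the singularity at `0`, `b` the growth at infinity, and `2` leaves
  -- an integrable majorant.
  refine ⟨(a + b + 2 : ℕ), by positivity, fun ξ => C * (1 + ‖ξ‖) ^ (-2 : ℝ),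
    (integrable_one_add_norm (by simp)).const_mul C, fun ξ hξ => ?_⟩
  have h1 : (1 : ℝ) ≤ 1 + |ξ| := by linarith [abs_nonneg ξ]
  have h0 : (0 : ℝ) < 1 + |ξ| := by linarith
  rw [Real.rpow_natCast, show (-(2 * ((a + b + 2 : ℕ) : ℝ))) = -((2 * (a + b + 2) : ℕ) : ℝ) by
    push_cast; ring, Real.rpow_neg h0.le, Real.rpow_natCast]
  simp only
  rw [Real.norm_eq_abs,
    show (-2 : ℝ) = -((2 : ℕ) : ℝ) by norm_num, Real.rpow_neg h0.le, Real.rpow_natCast]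
  rw [mul_right_comm, ← div_eq_mul_inv, ← div_eq_mul_inv, div_le_div_iff₀ (by positivity)
    (by positivity)]
  calc |ξ| ^ (a + b + 2) * ‖m ξ‖ * (1 + |ξ|) ^ 2
      = |ξ| ^ (b + 2) * (|ξ| ^ a * ‖m ξ‖) * (1 + |ξ|) ^ 2 := by ring
    _ ≤ (1 + |ξ|) ^ (b + 2) * (C * (1 + |ξ|) ^ b) * (1 + |ξ|) ^ 2 := by
        refine mul_le_mul_of_nonneg_right (mul_le_mul ?_ (hm ξ hξ) (by positivity) (by positivity))
          (by positivity)
        gcongr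
        linarith
    _ = C * (1 + |ξ|) ^ (2 * b + 4) := by ring
    _ ≤ C * (1 + |ξ|) ^ (2 * (a + b + 2)) := by
        gcongr C * ?_
        exact pow_le_pow_right₀ h1 (by omega)

end ResolventEstimates

/-! ### Fourier transforms of Schwartz functions and convolution kernels. -/

section FourierHat

variable {E : Type*} [NormedAddCommGroup E] [NormedSpace ℂ E]

open scoped FourierTransform

theorem fourierHat_eq_fourier (f : ℝ → E) (ξ : ℝ) :
    fourierHat f ξ = 𝓕 f (ξ / (2 * Real.pi)) := by
  rw [Real.fourier_real_eq_integral_exp_smul, fourierHat]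
  congr with t
  congr 2
  push_cast
  have : (Real.pi : ℂ) ≠ 0 := by exact_mod_cast Real.pi_ne_zero
  field_simp

theorem fourierHat_schwartz (f : 𝓢(ℝ, E)) :
    fourierHat (f : ℝ → E) = fun ξ => 𝓕 f ((2 * Real.pi)⁻¹ * ξ) := by
  ext ξ
  rw [fourierHat_eq_fourier, SchwartzMap.fourier_coe, div_eq_inv_mul]

theorem continuous_fourierHat (f : 𝓢(ℝ, E)) : Continuous (fourierHat (f : ℝ → E)) := by
  rw [fourierHat_schwartz]
  exact (𝓕 f).continuous.comp (by fun_prop)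

theorem iteratedDeriv_fourierHat (f : 𝓢(ℝ, E)) (k : ℕ) (ξ : ℝ) :
    iteratedDeriv k (fourierHat (f : ℝ → E)) ξ =
      ((2 * Real.pi)⁻¹) ^ k • iteratedDeriv k ((𝓕 f : 𝓢(ℝ, E)) : ℝ → E) ((2 * Real.pi)⁻¹ * ξ) := by
  rw [fourierHat_schwartz]
  have h := iteratedDeriv_comp_const_smul (n := k) ((𝓕 f).smooth k) ((2 * Real.pi)⁻¹)
  simpa using congrFun h ξ

theorem mem_homSchwartz_iff (f : 𝓢(ℝ, E)) :
    f ∈ homSchwartz E ↔ ∀ k : ℕ, iteratedDeriv k ((𝓕 f : 𝓢(ℝ, E)) : ℝ → E) 0 = 0 := by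
  have : (2 * Real.pi)⁻¹ ≠ 0 := by positivity
  simp only [homSchwartz, mem_ofPred_eq, iteratedDeriv_fourierHat, mul_zero, smul_eq_zero,
    pow_eq_zero_iff', this, false_and, false_or, ne_eq]

theorem integrable_fourierHat (f : 𝓢(ℝ, E)) : Integrable (fourierHat (f : ℝ → E)) := by
  rw [fourierHat_schwartz]
  exact (𝓕 f).integrable.comp_mul_left' (by positivity)

theorem integral_exp_smul_fourierHat [CompleteSpace E] (f : 𝓢(ℝ, E)) (t : ℝ) :
    ∫ ξ : ℝ, Complex.exp (Complex.I * ξ * t) • fourierHat (f : ℝ → E) ξ =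
      (2 * Real.pi) • f t := by
  have h1 : ∀ ξ : ℝ, Complex.exp (Complex.I * ξ * t) • fourierHat (f : ℝ → E) ξ =
      (fun w : ℝ => Complex.exp (2 * Real.pi * Complex.I * (w * t)) • 𝓕 f w)
        (ξ / (2 * Real.pi)) := by
    intro ξ
    rw [fourierHat_eq_fourier, SchwartzMap.fourier_coe]
    simp only
    congr 2
    push_cast
    have : (Real.pi : ℂ) ≠ 0 := by exact_mod_cast Real.pi_ne_zero
    field_simp
  simp only [h1]
  rw [Measure.integral_comp_div (fun w : ℝ =>
    Complex.exp (2 * Real.pi * Complex.I * (w * t)) • 𝓕 f w), abs_of_pos (by positivity)]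
  congr 1
  have h2 : 𝓕⁻ (𝓕 f) t = f t := by simp
  rw [SchwartzMap.fourierInv_coe, Real.fourierInv_eq'] at h2
  rw [← h2]
  congr with w
  congr 2
  simp
  ring

/-- A smooth function with bounded derivatives, all of which vanish at `0`, is `O(|x|^N)`. -/
theorem norm_le_pow_of_iteratedDeriv_eq_zero {F : Type*} [NormedAddCommGroup F] [NormedSpace ℝ F]
    (g : 𝓢(ℝ, F)) (h0 : ∀ k : ℕ, iteratedDeriv k g 0 = 0) (N : ℕ) :
    ∃ C : ℝ, 0 ≤ C ∧ ∀ x : ℝ, ‖g x‖ ≤ C * |x| ^ N := by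
  obtain ⟨C, hC, hb⟩ := g.decay 0 N
  refine ⟨C, hC.le, ?_⟩
  -- Descent from the bounded `N`-th derivative: each application of the mean value inequality from
  -- `0` lowers the order by one and gains a factor `|x|`.
  have key : ∀ i ≤ N, ∀ x : ℝ, ‖iteratedDeriv (N - i) g x‖ ≤ C * |x| ^ i := by
    intro i
    induction i with
    | zero =>
      intro _ x
      simpa [norm_iteratedFDeriv_eq_norm_iteratedDeriv] using hb x
    | succ i ih =>
      intro hi x
      have hd : ∀ y : ℝ, DifferentiableAt ℝ (iteratedDeriv (N - (i + 1)) g) y := fun y =>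
        ((g.smooth (N - (i + 1) + 1 : ℕ)).differentiable_iteratedDeriv' _) y
      have h1 := (convex_segment (𝕜 := ℝ) 0 x).norm_image_sub_le_of_norm_deriv_le
        (f := iteratedDeriv (N - (i + 1)) g) (C := C * |x| ^ i) (fun y _ => hd y)
        (fun y hy => by
          rw [← iteratedDeriv_succ, show N - (i + 1) + 1 = N - i by omega]
          refine (ih (by omega) y).trans ?_
          rw [segment_eq_uIcc] at hy
          have hyx : |y| ≤ |x| := by simpa using abs_sub_left_of_mem_uIcc hy
          gcongr)
        (left_mem_segment ℝ 0 x) (right_mem_segment ℝ 0 x)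
      rw [h0, sub_zero, sub_zero, Real.norm_eq_abs] at h1
      rw [pow_succ, ← mul_assoc]
      exact h1
  intro x
  simpa using key N le_rfl x

/-- Infinite-order vanishing handles `|ξ| ≤ 1`, and Schwartz decay handles `|ξ| ≥ 1`. Thus the
transform absorbs both the pole-like behaviour of the symbol at `0` and its growth at infinity. -/
theorem exists_norm_fourierHat_le {f : 𝓢(ℝ, E)} (hf : f ∈ homSchwartz E) (a b : ℕ) :
    ∃ C : ℝ, 0 ≤ C ∧ ∀ ξ : ℝ, (1 + |ξ|) ^ b * ‖fourierHat (f : ℝ → E) ξ‖ ≤ C * |ξ| ^ a := by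
  obtain ⟨C₁, hC₁, h1⟩ := norm_le_pow_of_iteratedDeriv_eq_zero (𝓕 f) ((mem_homSchwartz_iff f).1 hf) a
  obtain ⟨C₂, hC₂, h2⟩ := (𝓕 f).decay b 0
  set c : ℝ := (2 * Real.pi)⁻¹ with hc
  have hc0 : 0 < c := by positivity
  refine ⟨2 ^ b * (C₁ * c ^ a) + 2 ^ b * (C₂ / c ^ b), by positivity, fun ξ => ?_⟩
  rw [fourierHat_schwartz]
  simp only [← hc]
  rcases le_total |ξ| 1 with h | h
  · calc (1 + |ξ|) ^ b * ‖𝓕 f (c * ξ)‖ ≤ 2 ^ b * (C₁ * |c * ξ| ^ a) := by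
          gcongr
          · linarith
          · exact h1 _
      _ = 2 ^ b * (C₁ * c ^ a) * |ξ| ^ a := by rw [abs_mul, abs_of_pos hc0, mul_pow]; ring
      _ ≤ _ := by
          rw [add_mul]
          exact le_add_of_nonneg_right (by positivity)
  · have h3 : |ξ| ^ b * ‖𝓕 f (c * ξ)‖ ≤ C₂ / c ^ b := by
      have := h2 (c * ξ)
      rw [norm_iteratedFDeriv_zero, Real.norm_eq_abs, abs_mul, abs_of_pos hc0, mul_pow] at this
      rw [le_div_iff₀ (by positivity)]
      linarith
    calc (1 + |ξ|) ^ b * ‖𝓕 f (c * ξ)‖ ≤ (2 * |ξ|) ^ b * ‖𝓕 f (c * ξ)‖ := by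
          gcongr; linarith
      _ = 2 ^ b * (|ξ| ^ b * ‖𝓕 f (c * ξ)‖) := by rw [mul_pow]; ring
      _ ≤ 2 ^ b * (C₂ / c ^ b) := by gcongr
      _ ≤ 2 ^ b * (C₂ / c ^ b) * |ξ| ^ a :=
          le_mul_of_one_le_right (by positivity) (one_le_pow₀ h)
      _ ≤ _ := by
          rw [add_mul]
          exact le_add_of_nonneg_left (by positivity)

variable {F : Type*} [NormedAddCommGroup F] [NormedSpace ℂ F]

/-- A multiplier whose symbol is the Fourier transform of an integrable kernel is given by
integration against the kernel. -/
theorem integral_symbol_eq_integral_kernel [CompleteSpace E] [CompleteSpace F] (f : 𝓢(ℝ, E))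
    {K : ℝ → E →L[ℂ] F} (hKc : Continuous fun p : ℝ × E => K p.1 p.2) {κ : ℝ → ℝ}
    (hκ : IntegrableOn κ (Ioi 0)) (hK : ∀ s ∈ Ioi (0 : ℝ), ‖K s‖ ≤ κ s) (t : ℝ) :
    (1 / (2 * Real.pi) : ℝ) • ∫ ξ : ℝ, Complex.exp (Complex.I * ξ * t) •
      ∫ s in Ioi (0 : ℝ), Complex.exp (Complex.I * ξ * s) • K s (fourierHat (f : ℝ → E) ξ) =
    ∫ s in Ioi (0 : ℝ), K s (f (t + s)) := by
  set μ : Measure ℝ := volume.restrict (Ioi 0) with hμ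
  -- The two exponentials are merged, so that after Fubini the inner integral in `ξ` is Fourier
  -- inversion at the point `t + s`.
  set Φ : ℝ → ℝ → F := fun ξ s => Complex.exp (Complex.I * ξ * ((t + s : ℝ) : ℂ)) •
    K s (fourierHat (f : ℝ → E) ξ) with hΦ
  have hΦc : Continuous (Function.uncurry Φ) := by
    have h1 : Continuous fun p : ℝ × ℝ => K p.2 (fourierHat (f : ℝ → E) p.1) :=
      hKc.comp (continuous_snd.prodMk ((continuous_fourierHat f).comp continuous_fst))
    have h2 : Continuous fun p : ℝ × ℝ => Complex.exp (Complex.I * p.1 * ((t + p.2 : ℝ) : ℂ)) := by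
      fun_prop
    exact h2.smul h1
  have hexp : ∀ ξ r : ℝ, ‖Complex.exp (Complex.I * ξ * r)‖ = 1 := fun ξ r => by
    have := Complex.norm_exp_I_mul_ofReal (ξ * r)
    rwa [Complex.ofReal_mul, ← mul_assoc] at this
  have hΦi : Integrable (Function.uncurry Φ) (volume.prod μ) := by
    refine ((integrable_fourierHat f).norm.mul_prod hκ).mono' hΦc.aestronglyMeasurable ?_
    have h3 : ∀ᵐ p : ℝ × ℝ ∂(volume.prod μ), p.2 ∈ Ioi (0 : ℝ) :=
      Measure.quasiMeasurePreserving_snd.ae (ae_restrict_mem measurableSet_Ioi)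
    filter_upwards [h3] with p hp
    simp only [Function.uncurry, hΦ]
    rw [norm_smul, hexp, one_mul, mul_comm]
    exact (K p.2).le_of_opNorm_le (hK _ hp) _
  calc (1 / (2 * Real.pi) : ℝ) • ∫ ξ : ℝ, Complex.exp (Complex.I * ξ * t) •
        ∫ s in Ioi (0 : ℝ), Complex.exp (Complex.I * ξ * s) • K s (fourierHat (f : ℝ → E) ξ)
      = (1 / (2 * Real.pi) : ℝ) • ∫ ξ, ∫ s, Φ ξ s ∂μ := by
        congr with ξ
        rw [← integral_smul]
        congr with s
        rw [smul_smul, ← Complex.exp_add]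
        congr 2
        push_cast; ring
    _ = (1 / (2 * Real.pi) : ℝ) • ∫ s, (∫ ξ, Φ ξ s) ∂μ := by rw [integral_integral_swap hΦi]
    _ = (1 / (2 * Real.pi) : ℝ) • ∫ s, (2 * Real.pi) • K s (f (t + s)) ∂μ := by
        congr with s
        rw [← ContinuousLinearMap.map_smul_of_tower, ← integral_exp_smul_fourierHat,
          ← ContinuousLinearMap.integral_comp_comm]
        · simp only [hΦ, map_smul]
        · refine (integrable_fourierHat f).norm.mono' ?_ (Eventually.of_forall fun ξ => ?_)
          · exact ((by fun_prop : Continuous fun ξ : ℝ =>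
              Complex.exp (Complex.I * ξ * ((t + s : ℝ) : ℂ))).smul
              (continuous_fourierHat f)).aestronglyMeasurable
          · rw [norm_smul, hexp, one_mul]
    _ = _ := by
        rw [integral_smul, smul_smul, one_div, inv_mul_cancel₀ (by positivity), one_smul]

end FourierHat

/-! ### Young's inequality for bounded, decaying kernels. -/

section Young

/-- The pointwise estimate behind Young's convolution inequality. -/
theorem lintegral_mul_le_young {α : Type*} [MeasurableSpace α] {μ : Measure α} {p r θ : ℝ}
    (hp : 0 < p) (hr : 0 < r) (hθ : 0 ≤ θ) (hθr : θ ≤ 1 / r) (hθp : θ ≤ 1 / p)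
    (h : 1 / r + 1 / p = 1 + θ) {κ φ : α → ℝ≥0∞} (hκ : AEMeasurable κ μ) (hφ : AEMeasurable φ μ) :
    ∫⁻ a, κ a * φ a ∂μ ≤ (∫⁻ a, κ a ^ r * φ a ^ p ∂μ) ^ θ *
      (∫⁻ a, κ a ^ r ∂μ) ^ (1 / r - θ) * (∫⁻ a, φ a ^ p ∂μ) ^ (1 / p - θ) := by
  -- Three-factor Hölder for `κ φ = (κ^r φ^p)^θ (κ^r)^(1/r-θ) (φ^p)^(1/p-θ)`. The hypothesis `h`
  -- says that the three weights sum to `1`.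
  have key := ENNReal.lintegral_prod_norm_pow_le (μ := μ) (Finset.univ : Finset (Fin 3))
    (f := ![fun a => κ a ^ r * φ a ^ p, fun a => κ a ^ r, fun a => φ a ^ p])
    (p := ![θ, 1 / r - θ, 1 / p - θ])
    (by
      intro i _
      fin_cases i
      · exact (hκ.pow_const _).mul (hφ.pow_const _)
      · exact hκ.pow_const _
      · exact hφ.pow_const _)
    (by simp [Fin.sum_univ_three]; simp at h; linarith)
    (by
      intro i _
      fin_cases i
      · exact hθ
      · exact sub_nonneg.2 hθr
      · exact sub_nonneg.2 hθp)
  simp only [Fin.prod_univ_three, Matrix.cons_val_zero, Matrix.cons_val_one,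
    Matrix.cons_val_two, Matrix.head_cons, Matrix.tail_cons] at key
  refine le_trans (le_of_eq (lintegral_congr fun a => ?_)) key
  have e : ∀ (x : ℝ≥0∞) (r : ℝ), 0 < r → θ ≤ 1 / r → (x ^ r) ^ θ * (x ^ r) ^ (1 / r - θ) = x := by
    intro x r hr hθr
    rw [← ENNReal.rpow_add_of_nonneg _ _ hθ (sub_nonneg.2 hθr), add_sub_cancel, ← ENNReal.rpow_mul,
      mul_one_div_cancel hr.ne', ENNReal.rpow_one]
  rw [ENNReal.mul_rpow_of_nonneg _ _ hθ]
  conv_lhs => rw [← e (κ a) r hr hθr, ← e (φ a) p hp hθp]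
  ring

/-- With `θ = 1/q`, the `q`-th power of the pointwise estimate is linear in `∫ κ^r φ(t + ·)^p`. By
Tonelli and translation invariance this integrates over `t` to the product of the two integrals. -/
theorem lintegral_rpow_lintegral_mul_add_le {p q r : ℝ} (hp : 0 < p) (hq : 0 < q) (hr : 0 < r)
    (hqr : r ≤ q) (hqp : p ≤ q) (h : 1 / r + 1 / p = 1 + 1 / q) {κ φ : ℝ → ℝ≥0∞}
    (hκ : Measurable κ) (hφ : Measurable φ) :
    ∫⁻ t, (∫⁻ s, κ s * φ (t + s)) ^ q ≤ (∫⁻ s, κ s ^ r) ^ (q / r) * (∫⁻ s, φ s ^ p) ^ (q / p) := by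
  set a := ∫⁻ s, κ s ^ r with ha
  set b := ∫⁻ s, φ s ^ p with hb
  have e1 : 1 / q ≤ 1 / r := one_div_le_one_div_of_le hr hqr
  have e2 : 1 / q ≤ 1 / p := one_div_le_one_div_of_le hp hqp
  have hpt : ∀ t : ℝ, (∫⁻ s, κ s * φ (t + s)) ^ q ≤
      (∫⁻ s, κ s ^ r * φ (t + s) ^ p) * (a ^ (q / r - 1) * b ^ (q / p - 1)) := by
    intro t
    have h1 := lintegral_mul_le_young (μ := volume) hp hr (by positivity) e1 e2 h
      hκ.aemeasurable (hφ.comp (measurable_const_add t)).aemeasurable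
    simp only [Function.comp_def] at h1
    rw [lintegral_add_left_eq_self (fun s => φ s ^ p) t] at h1
    refine (ENNReal.rpow_le_rpow h1 hq.le).trans (le_of_eq ?_)
    rw [ENNReal.mul_rpow_of_nonneg _ _ hq.le, ENNReal.mul_rpow_of_nonneg _ _ hq.le,
      ← ENNReal.rpow_mul, ← ENNReal.rpow_mul, ← ENNReal.rpow_mul, one_div_mul_cancel hq.ne',
      ENNReal.rpow_one, mul_assoc]
    congr 3 <;> field_simp
  calc ∫⁻ t, (∫⁻ s, κ s * φ (t + s)) ^ q
      ≤ ∫⁻ t, (∫⁻ s, κ s ^ r * φ (t + s) ^ p) * (a ^ (q / r - 1) * b ^ (q / p - 1)) :=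
        lintegral_mono hpt
    _ = (∫⁻ t, ∫⁻ s, κ s ^ r * φ (t + s) ^ p) * (a ^ (q / r - 1) * b ^ (q / p - 1)) :=
        lintegral_mul_const _ (Measurable.lintegral_prod_right' (f := fun z : ℝ × ℝ =>
          κ z.2 ^ r * φ (z.1 + z.2) ^ p) (by fun_prop))
    _ = (a * b) * (a ^ (q / r - 1) * b ^ (q / p - 1)) := by
        congr 1
        rw [lintegral_lintegral_swap (by
          have : Measurable fun z : ℝ × ℝ => κ z.2 ^ r * φ (z.1 + z.2) ^ p := by fun_prop
          exact this.aemeasurable)]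
        have : ∀ s, ∫⁻ t, κ s ^ r * φ (t + s) ^ p = κ s ^ r * b := fun s => by
          rw [lintegral_const_mul _ (by fun_prop),
            lintegral_add_right_eq_self (fun t => φ t ^ p) s]
        simp only [this]
        rw [lintegral_mul_const _ (by fun_prop)]
    _ = a ^ (1 + (q / r - 1)) * b ^ (1 + (q / p - 1)) := by
        rw [ENNReal.rpow_add_of_nonneg _ _ zero_le_one (sub_nonneg.2 ((one_le_div hr).2 hqr)),
          ENNReal.rpow_add_of_nonneg _ _ zero_le_one (sub_nonneg.2 ((one_le_div hp).2 hqp)),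
          ENNReal.rpow_one, ENNReal.rpow_one]
        ring
    _ = _ := by rw [add_sub_cancel, add_sub_cancel]

variable {E F : Type*} [NormedAddCommGroup E] [NormedAddCommGroup F]

theorem eLpNorm_top_le_of_bounded_kernel {f : ℝ → E} (hf : Continuous f) {g : ℝ → F}
    {κ : ℝ → ℝ≥0∞} {K : ℝ≥0} (hκ : ∀ s, κ s ≤ K)
    (hg : ∀ t, ‖g t‖ₑ ≤ ∫⁻ s, κ s * ‖f (t + s)‖ₑ) :
    eLpNorm g ∞ volume ≤ K * eLpNorm f 1 volume := by
  rw [eLpNorm_exponent_top, eLpNorm_one_eq_lintegral_enorm]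
  refine essSup_le_of_ae_le _ (Eventually.of_forall fun t => (hg t).trans ?_)
  calc ∫⁻ s, κ s * ‖f (t + s)‖ₑ ≤ ∫⁻ s, K * ‖f (t + s)‖ₑ := by
        gcongr with s; exact hκ s
    _ = K * ∫⁻ s, ‖f (t + s)‖ₑ := lintegral_const_mul _
        (by fun_prop : Continuous fun s => ‖f (t + s)‖ₑ).measurable
    _ = _ := by rw [lintegral_add_left_eq_self (fun s => ‖f s‖ₑ) t]

/-- Young's inequality for a kernel that is bounded and lies in `L^r` for `r > 1` (for `r ≥ 1`
if `p = q`). -/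
theorem exists_eLpNorm_le_of_kernel {p q : ℝ≥0∞} (hp : 1 ≤ p) (hpq : p ≤ q)
    {κ : ℝ → ℝ≥0∞} (hκm : Measurable κ) {K : ℝ≥0} (hκ : ∀ s, κ s ≤ K)
    (hκr : ∀ r : ℝ, 1 ≤ r → (p < q → 1 < r) → ∫⁻ s, κ s ^ r ≠ ∞) :
    ∃ C : ℝ≥0, ∀ (f : ℝ → E) (g : ℝ → F), Continuous f →
      (∀ t, ‖g t‖ₑ ≤ ∫⁻ s, κ s * ‖f (t + s)‖ₑ) → eLpNorm g q volume ≤ C * eLpNorm f p volume := by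
  rcases eq_or_ne p ∞ with rfl | hp'
  · obtain rfl : q = ∞ := top_le_iff.1 hpq
    have h1 : ∫⁻ s, κ s ≠ ∞ := by simpa using hκr 1 le_rfl (fun h => absurd h (lt_irrefl _))
    refine ⟨(∫⁻ s, κ s).toNNReal, fun f g hf hg => ?_⟩
    rw [ENNReal.coe_toNNReal h1, eLpNorm_exponent_top, eLpNorm_exponent_top]
    refine essSup_le_of_ae_le _ (Eventually.of_forall fun t => (hg t).trans ?_)
    have h2 : ∀ᵐ s, ‖f (t + s)‖ₑ ≤ eLpNormEssSup f volume :=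
      (measurePreserving_add_left volume t).quasiMeasurePreserving.ae
        (ae_le_eLpNormEssSup (f := f))
    rw [← lintegral_mul_const _ hκm]
    refine lintegral_mono_ae ?_
    filter_upwards [h2] with s hs
    gcongr
  have hp0 : p ≠ 0 := (zero_lt_one.trans_le hp).ne'
  set P := p.toReal with hP
  have hP1 : 1 ≤ P := by
    rw [hP, ← ENNReal.toReal_one]
    exact ENNReal.toReal_mono hp' hp
  rcases eq_or_ne q ∞ with rfl | hq'
  · rcases eq_or_lt_of_le hP1 with hP1' | hP1'
    · have : p = 1 := by
        rw [← ENNReal.ofReal_toReal hp', ← hP, ← hP1', ENNReal.ofReal_one]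
      subst this
      exact ⟨K, fun f g hf hg => eLpNorm_top_le_of_bounded_kernel hf hκ hg⟩
    -- The conjugate exponent. Here `θ = 0`, and the three-factor estimate reduces to Hölder.
    · set r := P / (P - 1) with hr
      have hr1 : 1 < r := by
        rw [hr, one_lt_div (by linarith)]; linarith
      have h1 := hκr r hr1.le fun _ => hr1
      refine ⟨((∫⁻ s, κ s ^ r) ^ (1 / r)).toNNReal, fun f g hf hg => ?_⟩
      rw [ENNReal.coe_toNNReal (ENNReal.rpow_ne_top_of_nonneg (by positivity) h1),
        eLpNorm_exponent_top, eLpNorm_eq_lintegral_rpow_enorm_toReal hp0 hp']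
      refine essSup_le_of_ae_le _ (Eventually.of_forall fun t => (hg t).trans ?_)
      have h2 := lintegral_mul_le_young (μ := volume) (p := P) (r := r) (θ := 0) (by linarith)
        (by linarith) le_rfl (by positivity) (by positivity)
        (by rw [hr]; field_simp; ring) hκm.aemeasurable
        (φ := fun s => ‖f (t + s)‖ₑ) (by fun_prop)
      rw [lintegral_add_left_eq_self (fun s => ‖f s‖ₑ ^ P) t] at h2
      simpa using h2
  · have hq0 : q ≠ 0 := (zero_lt_one.trans_le (hp.trans hpq)).ne'
    set Q := q.toReal with hQ
    have hPQ : P ≤ Q := ENNReal.toReal_mono hq' hpq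
    have hQ1 : 1 ≤ Q := hP1.trans hPQ
    have hinv : 1 / Q ≤ 1 / P := one_div_le_one_div_of_le (by linarith) hPQ
    have hP2 : 1 / P ≤ 1 := by rw [div_le_one (by linarith)]; exact hP1
    have hQ2 : 0 < 1 / Q := by positivity
    -- The Young exponent, equal to `1` when `P = Q` and larger than `1` when `P < Q`, in accordance
    -- with the integrability hypothesis `hκr`.
    set r := 1 / (1 + 1 / Q - 1 / P) with hr
    have hden : 0 < 1 + 1 / Q - 1 / P := by linarith
    have hr0 : 0 < r := by positivity
    have hr1 : 1 ≤ r := by rw [hr, one_le_div hden]; linarith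
    have hrr : 1 / r = 1 + 1 / Q - 1 / P := by rw [hr, one_div_one_div]
    have hrQ : r ≤ Q := by
      rw [← one_div_le_one_div (by positivity) hr0, hrr]; linarith
    have h1 := hκr r hr1 fun hlt => by
      have : P < Q := (ENNReal.toReal_lt_toReal hp' hq').2 hlt
      have : 1 / Q < 1 / P := one_div_lt_one_div_of_lt (by linarith) this
      rw [hr, one_lt_div hden]; linarith
    refine ⟨((∫⁻ s, κ s ^ r) ^ (1 / r)).toNNReal, fun f g hf hg => ?_⟩
    rw [ENNReal.coe_toNNReal (ENNReal.rpow_ne_top_of_nonneg (by positivity) h1),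
      eLpNorm_eq_lintegral_rpow_enorm_toReal hp0 hp',
      eLpNorm_eq_lintegral_rpow_enorm_toReal hq0 hq', ← hP, ← hQ]
    have h2 := lintegral_rpow_lintegral_mul_add_le (p := P) (q := Q) (r := r) (by linarith)
      (by linarith) hr0 hrQ hPQ (by rw [hrr]; ring) hκm (φ := fun s => ‖f s‖ₑ) hf.enorm.measurable
    have h3 : ∫⁻ t, ‖g t‖ₑ ^ Q ≤ (∫⁻ s, κ s ^ r) ^ (Q / r) * (∫⁻ s, ‖f s‖ₑ ^ P) ^ (Q / P) :=
      (lintegral_mono fun t => ENNReal.rpow_le_rpow (hg t) (by linarith)).trans h2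
    refine (ENNReal.rpow_le_rpow h3 (by positivity : 0 ≤ 1 / Q)).trans (le_of_eq ?_)
    rw [ENNReal.mul_rpow_of_nonneg _ _ (by positivity), ← ENNReal.rpow_mul, ← ENNReal.rpow_mul]
    congr 2 <;> field_simp

/-- The kernel `K (1 + |s|)^{-d}`. -/
def decayKernel (K : ℝ≥0) (d : ℕ) (s : ℝ) : ℝ≥0∞ := ENNReal.ofReal (K * (1 + ‖s‖) ^ (-(d : ℝ)))

theorem measurable_decayKernel (K : ℝ≥0) (d : ℕ) : Measurable (decayKernel K d) := by
  unfold decayKernel; fun_prop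

theorem decayKernel_le (K : ℝ≥0) (d : ℕ) (s : ℝ) : decayKernel K d s ≤ K := by
  rw [decayKernel, ← ENNReal.ofReal_coe_nnreal]
  refine ENNReal.ofReal_le_ofReal (mul_le_of_le_one_right K.coe_nonneg ?_)
  exact Real.rpow_le_one_of_one_le_of_nonpos (by linarith [norm_nonneg s]) (by simp)

theorem lintegral_decayKernel_rpow_ne_top (K : ℝ≥0) {d : ℕ} {r : ℝ} (hr : 0 < r) (hd : 1 < d * r) :
    ∫⁻ s, decayKernel K d s ^ r ≠ ∞ := by
  have h1 : ∀ s : ℝ, decayKernel K d s ^ r =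
      (K : ℝ≥0∞) ^ r * ENNReal.ofReal ((1 + ‖s‖) ^ (-(d * r))) := by
    intro s
    rw [decayKernel, ENNReal.ofReal_mul K.coe_nonneg, ENNReal.mul_rpow_of_nonneg _ _ hr.le,
      ENNReal.ofReal_coe_nnreal, ENNReal.ofReal_rpow_of_nonneg (by positivity) hr.le,
      ← Real.rpow_mul (by positivity), neg_mul]
  simp only [h1]
  rw [lintegral_const_mul _ (by fun_prop)]
  exact ENNReal.mul_ne_top (ENNReal.rpow_ne_top_of_nonneg hr.le ENNReal.coe_ne_top)
    (finite_integral_one_add_norm (by simpa using hd)).ne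

end Young

/-! ### Stability implies the multiplier bounds. -/

section StabilityToMultipliers

variable {X : Type*} [NormedAddCommGroup X] [NormedSpace ℂ X]
  {Y : Type*} [NormedAddCommGroup Y] [NormedSpace ℂ Y]

theorem integrableOn_pow_smul_of_le {E : Type*} [NormedAddCommGroup E] [NormedSpace ℝ E]
    {g : ℝ → E} (hg : Continuous g) {i n : ℕ} (hi : i ≤ n)
    (h : IntegrableOn (fun s : ℝ => s ^ n • g s) (Ioi 0)) :
    IntegrableOn (fun s : ℝ => s ^ i • g s) (Ioi 0) := by
  have hc : Continuous fun s : ℝ => s ^ i • g s := (continuous_pow i).smul hg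
  rw [← Ioc_union_Ioi_eq_Ioi zero_le_one]
  refine IntegrableOn.union (hc.integrableOn_Icc.mono_set Ioc_subset_Icc_self) ?_
  refine (h.mono_set (Ioi_subset_Ioi zero_le_one)).norm.mono' hc.aestronglyMeasurable ?_
  filter_upwards [ae_restrict_mem measurableSet_Ioi] with s hs
  rw [norm_smul, norm_smul, norm_pow, norm_pow, Real.norm_eq_abs]
  have : 1 ≤ |s| := (mem_Ioi.1 hs).le.trans (le_abs_self s)
  gcongr

theorem norm_exp_I_mul_mul (ξ t : ℝ) : ‖Complex.exp (Complex.I * ξ * t)‖ = 1 := by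
  have := Complex.norm_exp_I_mul_ofReal (ξ * t)
  rwa [Complex.ofReal_mul, ← mul_assoc] at this

/-- This is the integrable majorant, independent of `ε`, for removing the regularisation. The weight
`b + 2` on the transform leaves two powers of decay after compensating the symbol. -/
theorem HasResolventGrowth.exists_norm_shiftedResolventPow_fourierHat_le {A : X →ₗ.[ℂ] X}
    {α β : ℝ} (hα : 0 ≤ α) (h : HasResolventGrowth A α β) (ι : Y →L[ℂ] X) {k : ℕ} (hk : 1 ≤ k)
    {f : 𝓢(ℝ, Y)} (hf : f ∈ homSchwartz Y) :
    ∃ D : ℝ, ∀ ε ∈ Icc (0 : ℝ) 1, ∀ ξ : ℝ, ξ ≠ 0 →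
      ‖shiftedResolventPow A ι k ε ξ (fourierHat (f : ℝ → Y) ξ)‖ ≤ D * (1 + ‖ξ‖) ^ (-2 : ℝ) := by
  obtain ⟨C, a, b, hC, hb⟩ := h.exists_norm_shiftedResolventPow_le hα ι hk
  obtain ⟨C', hC', hb'⟩ := exists_norm_fourierHat_le hf a (b + 2)
  refine ⟨C * C', fun ε hε ξ hξ => ?_⟩
  have h1 := hb ε hε ξ hξ
  have h2 := hb' ξ
  have hξ' : 0 < |ξ| := abs_pos.2 hξ
  set u := ‖shiftedResolventPow A ι k ε ξ‖
  set v := ‖fourierHat (f : ℝ → Y) ξ‖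
  have h3 : u * v * (1 + |ξ|) ^ 2 ≤ C * C' := by
    have h4 : |ξ| ^ a * u * ((1 + |ξ|) ^ (b + 2) * v) ≤ C * (1 + |ξ|) ^ b * (C' * |ξ| ^ a) :=
      mul_le_mul h1 h2 (by positivity) (by positivity)
    have h5 : 0 < |ξ| ^ a * (1 + |ξ|) ^ b := by positivity
    refine le_of_mul_le_mul_left ?_ h5
    calc _ = |ξ| ^ a * u * ((1 + |ξ|) ^ (b + 2) * v) := by ring
      _ ≤ _ := h4
      _ = _ := by ring
  rw [show (-2 : ℝ) = -((2 : ℕ) : ℝ) by norm_num, Real.rpow_neg (by positivity),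
    Real.rpow_natCast, ← div_eq_mul_inv, le_div_iff₀ (by positivity), Real.norm_eq_abs]
  refine le_trans ?_ h3
  gcongr
  exact ContinuousLinearMap.le_opNorm _ _

theorem HasResolventGrowth.aestronglyMeasurable_shiftedResolventPow_fourierHat {A : X →ₗ.[ℂ] X}
    {α β : ℝ} (h : HasResolventGrowth A α β) (ι : Y →L[ℂ] X) (k : ℕ) (f : 𝓢(ℝ, Y)) {ε : ℝ}
    (hε : 0 ≤ ε) :
    AEStronglyMeasurable
      (fun ξ => shiftedResolventPow A ι k ε ξ (fourierHat (f : ℝ → Y) ξ)) volume :=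
  aestronglyMeasurable_of_continuousOn_compl_zero
    ((h.continuousOn_shiftedResolventPow ι k hε).clm_apply (continuous_fourierHat f).continuousOn)

theorem HasResolventGrowth.integrable_resolventPow_fourierHat {A : X →ₗ.[ℂ] X}
    {α β : ℝ} (hα : 0 ≤ α) (h : HasResolventGrowth A α β) (ι : Y →L[ℂ] X) {k : ℕ} (hk : 1 ≤ k)
    {f : 𝓢(ℝ, Y)} (hf : f ∈ homSchwartz Y) :
    Integrable (fun ξ => resolventPow A ι k ξ (fourierHat (f : ℝ → Y) ξ)) := by
  obtain ⟨D, hD⟩ := h.exists_norm_shiftedResolventPow_fourierHat_le hα ι hk hf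
  rw [← shiftedResolventPow_zero]
  refine ((integrable_one_add_norm (r := 2) (by simp)).const_mul D).mono'
    (h.aestronglyMeasurable_shiftedResolventPow_fourierHat ι k f le_rfl) ?_
  filter_upwards [compl_mem_ae_iff.2 (measure_singleton (0 : ℝ))] with ξ hξ
  exact hD 0 (by simp) ξ hξ

theorem HasResolventGrowth.tendsto_multiplierOp {A : X →ₗ.[ℂ] X}
    {α β : ℝ} (hα : 0 ≤ α) (h : HasResolventGrowth A α β) (ι : Y →L[ℂ] X) {k : ℕ} (hk : 1 ≤ k)
    {f : 𝓢(ℝ, Y)} (hf : f ∈ homSchwartz Y) (t : ℝ) :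
    Tendsto (fun ε => multiplierOp (shiftedResolventPow A ι k ε) f t) (𝓝[>] 0)
      (𝓝 (multiplierOp (resolventPow A ι k) f t)) := by
  obtain ⟨D, hD⟩ := h.exists_norm_shiftedResolventPow_fourierHat_le hα ι hk hf
  have hne : ∀ᵐ ξ : ℝ, ξ ≠ 0 := compl_mem_ae_iff.2 (measure_singleton (0 : ℝ))
  have hmem : ∀ᶠ ε : ℝ in 𝓝[>] 0, ε ∈ Ioc (0 : ℝ) 1 := Ioc_mem_nhdsGT zero_lt_one
  refine Tendsto.const_smul ?_ _
  refine tendsto_integral_filter_of_dominated_convergence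
    (fun ξ => D * (1 + ‖ξ‖) ^ (-2 : ℝ)) ?_ ?_ ((integrable_one_add_norm (by simp)).const_mul D) ?_
  · filter_upwards [hmem] with ε hε
    exact (by fun_prop : Continuous fun ξ : ℝ =>
      Complex.exp (Complex.I * ξ * t)).aestronglyMeasurable.smul
      (h.aestronglyMeasurable_shiftedResolventPow_fourierHat ι k f hε.1.le)
  · filter_upwards [hmem] with ε hε
    filter_upwards [hne] with ξ hξ
    rw [norm_smul, norm_exp_I_mul_mul, one_mul]
    exact hD ε ⟨hε.1.le, hε.2⟩ ξ hξ
  · filter_upwards [hne] with ξ hξ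
    refine Tendsto.const_smul ?_ _
    exact ((ContinuousLinearMap.apply ℂ X (fourierHat (f : ℝ → Y) ξ)).continuous.tendsto _).comp
      (h.tendsto_shiftedResolventPow ι k hξ)

variable [CompleteSpace X] {T : ℝ → X →L[ℂ] X}

/-- For `s ≤ 1` the semigroup is bounded. For `s ≥ 1` the exponents `k - 1` and `n + 1 - k` add up
to `n`, which is the weight in the stability hypothesis. -/
theorem PolynomiallyStable.exists_weighted_bound (hT : IsC0Semigroup T) {n : ℕ} {ι : Y →L[ℂ] X}
    (hs : PolynomiallyStable T n ι) {k : ℕ} (hk : 1 ≤ k) (hkn : k ≤ n + 1) :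
    ∃ K : ℝ≥0, ∀ s : ℝ, 0 < s →
      s ^ (k - 1) * ‖(T s).comp ι‖ ≤ K * (1 + ‖s‖) ^ (-((n + 1 - k : ℕ) : ℝ)) := by
  obtain ⟨B, hB⟩ := hs
  obtain ⟨M, hM, hb⟩ := hT.exists_bound 1
  set d := n + 1 - k with hd
  have hBs : ∀ s : ℝ, 0 < s → s ^ n * ‖(T s).comp ι‖ ≤ B := fun s hs => by
    have := hB ⟨s, hs.le, rfl⟩
    simp only at this
    rwa [norm_smul, norm_pow, Complex.norm_real, Real.norm_eq_abs, abs_of_pos hs] at this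
  have hB0 : 0 ≤ B := le_trans (by positivity) (hBs 1 one_pos)
  have hM0 : 0 ≤ M := by linarith
  refine ⟨⟨2 ^ d * (M * ‖ι‖ + B), by positivity⟩, fun s hs => ?_⟩
  rw [Real.rpow_neg (by positivity), Real.rpow_natCast, ← div_eq_mul_inv,
    le_div_iff₀ (by positivity), Real.norm_eq_abs, abs_of_pos hs]
  change _ ≤ 2 ^ d * (M * ‖ι‖ + B)
  rcases le_total s 1 with h | h
  · calc s ^ (k - 1) * ‖(T s).comp ι‖ * (1 + s) ^ d
        ≤ 1 * (M * ‖ι‖) * 2 ^ d := by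
          gcongr
          · exact pow_le_one₀ hs.le h
          · exact (ContinuousLinearMap.opNorm_comp_le _ _).trans
              (by gcongr; exact hb s ⟨hs.le, h⟩)
          · linarith
      _ ≤ _ := by nlinarith [pow_pos (zero_lt_two (α := ℝ)) d]
  · calc s ^ (k - 1) * ‖(T s).comp ι‖ * (1 + s) ^ d
        ≤ s ^ (k - 1) * ‖(T s).comp ι‖ * (2 * s) ^ d := by gcongr; linarith
      _ = 2 ^ d * (s ^ n * ‖(T s).comp ι‖) := by
          rw [show n = k - 1 + d by omega, pow_add, mul_pow]; ring
      _ ≤ 2 ^ d * (M * ‖ι‖ + B) := by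
          gcongr
          have := hBs s hs
          have : 0 ≤ M * ‖ι‖ := by positivity
          linarith

theorem IsC0Semigroup.continuous_uncurry_comp (hT : IsC0Semigroup T) (ι : Y →L[ℂ] X) {w : ℝ → ℂ}
    (hw : Continuous w) : Continuous fun p : ℝ × Y => (w p.1 • (T (max p.1 0)).comp ι) p.2 := by
  have h : Continuous fun p : ℝ × Y => T (max p.1 0) (ι p.2) :=
    hT.continuous_uncurry.comp (continuous_fst.prodMk (ι.continuous.comp continuous_snd))
  exact (hw.comp continuous_fst).smul h

variable [CompleteSpace Y]

/-- At `ε > 0` the kernel `e^(-εs) s^(k-1) T(s)` is absolutely integrable, so the multiplier is a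
genuine convolution-type integral. Dropping `e^(-εs) ≤ 1` gives a pointwise bound free of `ε`, which
survives the limit even when the limiting kernel is not integrable. -/
theorem enorm_multiplierOp_resolventPow_le (hT : IsC0Semigroup T) {A : X →ₗ.[ℂ] X}
    (hA : IsGenerator (-A) T) {α β : ℝ} (hα : 0 ≤ α) (h : HasResolventGrowth A α β)
    {ι : Y →L[ℂ] X} {k d : ℕ} (hk : 1 ≤ k) {K : ℝ≥0}
    (hK : ∀ s : ℝ, 0 < s → s ^ (k - 1) * ‖(T s).comp ι‖ ≤ K * (1 + ‖s‖) ^ (-(d : ℝ)))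
    {f : 𝓢(ℝ, Y)} (hf : f ∈ homSchwartz Y) (t : ℝ) :
    ‖multiplierOp (resolventPow A ι k) f t‖ₑ ≤ ∫⁻ s, decayKernel K d s * ‖f (t + s)‖ₑ := by
  obtain ⟨j, rfl⟩ : ∃ j, k = j + 1 := ⟨k - 1, by omega⟩
  simp only [Nat.add_sub_cancel] at hK
  refine le_of_tendsto (h.tendsto_multiplierOp hα ι hk hf t).enorm ?_
  filter_upwards [self_mem_nhdsWithin] with ε hε
  have hε : 0 < ε := hε
  set w : ℝ → ℂ := fun s => ((s ^ j * Real.exp (-(ε * s)) : ℝ) : ℂ) with hw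
  set κ : ℝ → Y →L[ℂ] X := fun s => w s • (T (max s 0)).comp ι with hκ
  have hwc : Continuous w := by fun_prop
  have hκc := hT.continuous_uncurry_comp ι hwc
  have hnorm : ∀ s ∈ Ioi (0 : ℝ), ‖κ s‖ = Real.exp (-(ε * s)) * (s ^ j * ‖(T s).comp ι‖) := by
    intro s hs
    have hs' : 0 < s := hs
    rw [hκ]
    simp only [hw]
    rw [norm_smul, Complex.norm_real, Real.norm_of_nonneg (by positivity), max_eq_left hs'.le]
    ring
  have hdecay : ∀ s : ℝ, (1 + ‖s‖) ^ (-(d : ℝ)) ≤ 1 := fun s =>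
    Real.rpow_le_one_of_one_le_of_nonpos (by linarith [norm_nonneg s]) (by simp)
  have hle : ∀ s ∈ Ioi (0 : ℝ), ‖κ s‖ ≤ K * Real.exp (-ε * s) := by
    intro s hs
    rw [hnorm s hs, mul_comm, neg_mul]
    gcongr
    exact (hK s hs).trans (mul_le_of_le_one_right K.coe_nonneg (hdecay s))
  have hint : IntegrableOn (fun s : ℝ => K * Real.exp (-ε * s)) (Ioi 0) :=
    (exp_neg_integrableOn_Ioi 0 hε).const_mul _
  have hsymb : ∀ ξ : ℝ, ξ ≠ 0 → ∀ v : Y, shiftedResolventPow A ι (j + 1) ε ξ v =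
      ((-1) ^ (j + 1) * (j.factorial : ℝ)⁻¹) •
        ∫ s in Ioi (0 : ℝ), Complex.exp (Complex.I * ξ * s) • κ s v := by
    intro ξ hξ v
    have hR : IsResolventAt A (-(ε - Complex.I * ξ)) (opResolvent A (Complex.I * ξ - ε)) := by
      rw [neg_sub]
      exact isResolventAt_opResolvent (h.mem_opResolventSet hε.le hξ)
    have hEq : ∀ i : ℕ, ∀ s ∈ Ioi (0 : ℝ),
        s ^ i • Complex.exp (-((ε - Complex.I * ξ) * s)) • T s (ι v) =
        (((s ^ i * Real.exp (-(ε * s)) : ℝ) : ℂ) * Complex.exp (Complex.I * ξ * s)) •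
          T (max s 0) (ι v) := by
      intro i s hs
      rw [max_eq_left (mem_Ioi.1 hs).le, ← Complex.coe_smul, smul_smul]
      congr 1
      push_cast
      rw [mul_assoc, ← Complex.exp_add]
      congr 2
      ring
    have hTi : ∀ i ≤ j, IntegrableOn
        (fun s : ℝ => s ^ i • Complex.exp (-((ε - Complex.I * ξ) * s)) • T s (ι v)) (Ioi 0) := by
      intro i hi
      have hmax : EqOn (fun s : ℝ => s ^ i • Complex.exp (-((ε - Complex.I * ξ) * s)) •
          T (max s 0) (ι v)) (fun s : ℝ => s ^ i • Complex.exp (-((ε - Complex.I * ξ) * s)) •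
          T s (ι v)) (Ioi 0) := fun s hs => by
        simp only [max_eq_left (mem_Ioi.1 hs).le]
      have hgc : Continuous fun s : ℝ => Complex.exp (-((ε - Complex.I * ξ) * s)) •
          T (max s 0) (ι v) :=
        (by fun_prop : Continuous fun s : ℝ => Complex.exp (-((ε - Complex.I * ξ) * s))).smul
          (hT.continuous_orbit _)
      refine IntegrableOn.congr_fun (integrableOn_pow_smul_of_le hgc hi ?_) hmax measurableSet_Ioi
      refine (hint.mul_const ‖v‖).mono' ((continuous_pow j).smul hgc).aestronglyMeasurable ?_
      filter_upwards [ae_restrict_mem measurableSet_Ioi] with s hs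
      have hs1 := hEq j s hs
      simp only [max_eq_left (mem_Ioi.1 hs).le] at hs1 ⊢
      rw [hs1, mul_comm, ← smul_smul, norm_smul, norm_exp_I_mul_mul, one_mul]
      have := (κ s).le_of_opNorm_le (hle s hs) v
      simpa only [hκ, hw, smul_apply, ContinuousLinearMap.comp_apply,
        max_eq_left (mem_Ioi.1 hs).le] using this
    have h1 := hT.resolvent_pow_eq_laplace hA hR hTi j le_rfl
    rw [shiftedResolventPow, ContinuousLinearMap.comp_apply, h1]
    congr 1
    refine setIntegral_congr_fun measurableSet_Ioi fun s hs => ?_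
    rw [hEq j s hs, mul_comm, ← smul_smul]
    rfl
  have hop : multiplierOp (shiftedResolventPow A ι (j + 1) ε) f t =
      ((-1) ^ (j + 1) * (j.factorial : ℝ)⁻¹) • ∫ s in Ioi (0 : ℝ), κ s (f (t + s)) := by
    rw [← integral_symbol_eq_integral_kernel f hκc hint hle t, smul_comm, multiplierOp]
    congr 1
    rw [← integral_smul]
    refine integral_congr_ae ?_
    filter_upwards [compl_mem_ae_iff.2 (measure_singleton (0 : ℝ))] with ξ hξ
    rw [hsymb ξ hξ, smul_comm]
  rw [hop, enorm_smul]
  -- The factor `1 / j!` is not needed and is estimated by `1`.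
  have hc : ‖((-1) ^ (j + 1) * (j.factorial : ℝ)⁻¹ : ℝ)‖ₑ ≤ 1 := by
    rw [← ofReal_norm, norm_mul, norm_pow, norm_neg, norm_one, one_pow, one_mul,
      Real.norm_of_nonneg (by positivity)]
    rw [ENNReal.ofReal_le_one]
    exact inv_le_one_of_one_le₀ (by exact_mod_cast Nat.one_le_iff_ne_zero.2 j.factorial_ne_zero)
  calc _ ≤ 1 * ‖∫ s in Ioi (0 : ℝ), κ s (f (t + s))‖ₑ := by gcongr
    _ ≤ ∫⁻ s in Ioi (0 : ℝ), ‖κ s (f (t + s))‖ₑ := by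
        rw [one_mul]; exact enorm_integral_le_lintegral_enorm _
    _ ≤ ∫⁻ s in Ioi (0 : ℝ), decayKernel K d s * ‖f (t + s)‖ₑ := by
        refine setLIntegral_mono' measurableSet_Ioi fun s hs => ?_
        refine (ContinuousLinearMap.le_opENorm _ _).trans ?_
        gcongr
        rw [decayKernel, ← ofReal_norm]
        refine ENNReal.ofReal_le_ofReal ?_
        rw [hnorm s hs]
        refine (mul_le_of_le_one_left (by have := mem_Ioi.1 hs; positivity) ?_).trans (hK s hs)
        rw [Real.exp_le_one_iff]
        have : 0 < ε * s := mul_pos hε hs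
        linarith
    _ ≤ _ := setLIntegral_le_lintegral _ _

omit [CompleteSpace X] [CompleteSpace Y] in
theorem HasResolventGrowth.isFourierMultiplier_of_eLpNorm_le {A : X →ₗ.[ℂ] X} {α β : ℝ}
    (hα : 0 ≤ α) (h : HasResolventGrowth A α β) (ι : Y →L[ℂ] X) {k : ℕ} (hk : 1 ≤ k)
    {p q : ℝ≥0∞} (hb : ∃ C : ℝ≥0, ∀ f ∈ homSchwartz Y,
      eLpNorm (multiplierOp (resolventPow A ι k) f) q volume ≤ C * eLpNorm (f : ℝ → Y) p volume) :
    IsFourierMultiplier p q (resolventPow A ι k) where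
  stronglyMeasurable x := by
    rw [← shiftedResolventPow_zero]
    exact aestronglyMeasurable_of_continuousOn_compl_zero
      ((h.continuousOn_shiftedResolventPow ι k le_rfl).clm_apply continuousOn_const)
  moderateGrowth := by
    obtain ⟨C, a, b, -, hC⟩ := h.exists_norm_shiftedResolventPow_le hα ι hk
    rw [← shiftedResolventPow_zero]
    exact moderateGrowth_of_polynomial_bound (hC 0 (by simp))
  bounded := hb

theorem PolynomiallyStable.isFourierMultiplier_one_top (hT : IsC0Semigroup T) {A : X →ₗ.[ℂ] X}
    (hA : IsGenerator (-A) T) {α β : ℝ} (hα : 0 ≤ α) (h : HasResolventGrowth A α β)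
    {n : ℕ} {ι : Y →L[ℂ] X} (hs : PolynomiallyStable T n ι) {k : ℕ} (hk : 1 ≤ k)
    (hkn : k ≤ n + 1) : IsFourierMultiplier 1 ∞ (resolventPow A ι k) := by
  obtain ⟨K, hK⟩ := hs.exists_weighted_bound hT hk hkn
  exact h.isFourierMultiplier_of_eLpNorm_le hα ι hk ⟨K, fun f hf =>
    eLpNorm_top_le_of_bounded_kernel f.continuous (decayKernel_le K _)
      (enorm_multiplierOp_resolventPow_le hT hA hα h hk hK hf)⟩

/-- The kernel decays like `(1 + s)^(-(n+1-k))`. For `k = n` this is the borderline rate, which lies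
in `L^r` only for `r > 1` and so forces `p < q`. For `k < n` it is integrable, and `p = q` is
allowed. -/
theorem PolynomiallyStable.isFourierMultiplier (hT : IsC0Semigroup T) {A : X →ₗ.[ℂ] X}
    (hA : IsGenerator (-A) T) {α β : ℝ} (hα : 0 ≤ α) (h : HasResolventGrowth A α β)
    {n : ℕ} {ι : Y →L[ℂ] X} (hs : PolynomiallyStable T n ι) {k : ℕ} (hk : 1 ≤ k)
    (hkn : k ≤ n) {p q : ℝ≥0∞} (hp : 1 ≤ p) (hpq : p ≤ q) (hlt : k = n → p < q) :
    IsFourierMultiplier p q (resolventPow A ι k) := by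
  obtain ⟨K, hK⟩ := hs.exists_weighted_bound hT hk (by omega)
  obtain ⟨C, hC⟩ := exists_eLpNorm_le_of_kernel (E := Y) (F := X) hp hpq
    (measurable_decayKernel K (n + 1 - k)) (decayKernel_le K _) fun r hr hr' => by
      refine lintegral_decayKernel_rpow_ne_top K (by linarith) ?_
      rcases eq_or_lt_of_le hkn with rfl | hlt'
      · simpa using hr' (hlt rfl)
      · have : (2 : ℝ) ≤ ((n + 1 - k : ℕ) : ℝ) := by exact_mod_cast (by omega : 2 ≤ n + 1 - k)
        nlinarith
  exact h.isFourierMultiplier_of_eLpNorm_le hα ι hk ⟨C, fun f hf => hC f _ f.continuous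
    (enorm_multiplierOp_resolventPow_le hT hA hα h hk hK hf)⟩

omit [CompleteSpace X] [CompleteSpace Y] in
theorem isFourierMultiplier_zero (p q : ℝ≥0∞) :
    IsFourierMultiplier p q (fun _ : ℝ => (0 : Y →L[ℂ] X)) where
  stronglyMeasurable _ := aestronglyMeasurable_const
  moderateGrowth := ⟨0, le_rfl, fun _ => 0, integrable_zero _ _ _, fun _ _ => by simp⟩
  bounded := ⟨0, fun f _ => by
    have : multiplierOp (fun _ : ℝ => (0 : Y →L[ℂ] X)) f = fun _ => 0 := by
      ext t; simp [multiplierOp]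
    simp [this]⟩

theorem PolynomiallyStable.resolventMultipliers (hT : IsC0Semigroup T) {A : X →ₗ.[ℂ] X}
    (hA : IsGenerator (-A) T) {α β : ℝ} (hα : 0 ≤ α) (h : HasResolventGrowth A α β)
    {n : ℕ} {ι : Y →L[ℂ] X} (hs : PolynomiallyStable T n ι) : ResolventMultipliers A n ι := by
  -- With `ψ = 0`, `p = 1`, `q = ∞` the low-frequency symbol vanishes and the other one is the full
  -- symbol, bounded from `L^1` to `L^∞` for all `k ≤ n + 1`.
  refine ⟨fun _ => 0, contDiff_const, HasCompactSupport.zero, 1, ∞, le_rfl, ENNReal.one_lt_top,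
    le_top, fun k hk _ hkn => ⟨?_, ?_⟩⟩
  · simpa only [zero_smul] using isFourierMultiplier_zero 1 ∞
  · simpa only [sub_zero, one_smul] using hs.isFourierMultiplier_one_top hT hA hα h hk hkn

end StabilityToMultipliers

/-! ### Scalar test functions with Fourier transform vanishing near zero. -/

section TestFunctions

open scoped FourierTransform

theorem exists_schwartz_fourier_eq_one_near_zero :
    ∃ η : 𝓢(ℝ, ℂ), ∀ᶠ w in 𝓝 (0 : ℝ), 𝓕 η w = 1 := by
  let b : ContDiffBump (0 : ℝ) := ⟨1, 2, one_pos, one_lt_two⟩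
  have h1 : HasCompactSupport fun x : ℝ => ((b x : ℝ) : ℂ) :=
    b.hasCompactSupport.comp_left (g := fun x : ℝ => (x : ℂ)) Complex.ofReal_zero
  have h2 : ContDiff ℝ (⊤ : ℕ∞) fun x : ℝ => ((b x : ℝ) : ℂ) :=
    Complex.ofRealCLM.contDiff.comp b.contDiff
  refine ⟨𝓕⁻ (h1.toSchwartzMap h2), ?_⟩
  filter_upwards [b.eventuallyEq_one] with w hw
  rw [FourierTransform.fourier_fourierInv_eq]
  change ((b w : ℝ) : ℂ) = 1
  rw [hw]; simp

/-- This scaling preserves the `L^1` norm and multiplies the sup norm by `δ`, at the price of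
compressing the Fourier transform towards `0`. -/
theorem exists_schwartz_dilation (η : 𝓢(ℝ, ℂ)) {δ : ℝ} (hδ : 0 < δ) :
    ∃ g : 𝓢(ℝ, ℂ), (∀ t, g t = δ * η (δ * t)) ∧ ∀ w, 𝓕 g w = 𝓕 η (w / δ) := by
  let e : ℝ ≃L[ℝ] ℝ := ContinuousLinearEquiv.unitsEquivAut ℝ (Units.mk0 δ hδ.ne')
  have he : ∀ t : ℝ, e t = δ * t := fun t => by simp [e, mul_comm]
  have hg : ∀ t, ((δ : ℂ) • SchwartzMap.compCLMOfContinuousLinearEquiv ℂ e η) t =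
      δ * η (δ * t) := fun t => by simp [he]
  refine ⟨(δ : ℂ) • SchwartzMap.compCLMOfContinuousLinearEquiv ℂ e η, hg, fun w => ?_⟩
  rw [SchwartzMap.fourier_coe, SchwartzMap.fourier_coe, Real.fourier_real_eq_integral_exp_smul,
    Real.fourier_real_eq_integral_exp_smul]
  have h1 := Measure.integral_comp_mul_left (fun u : ℝ =>
    Complex.exp (↑(-2 * Real.pi * u * (w / δ)) * Complex.I) • η u) δ
  rw [abs_of_pos (inv_pos.2 hδ), eq_inv_smul_iff₀ hδ.ne', ← integral_smul] at h1
  rw [← h1]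
  congr with t
  rw [hg, Complex.real_smul, smul_eq_mul, smul_eq_mul, ← mul_assoc, ← mul_assoc, mul_comm (δ : ℂ)]
  congr 4
  field_simp

/-- A Schwartz function differs from one whose Fourier transform vanishes near `0` by a function
that is controlled in `L^1` and arbitrarily small in `L^∞`. -/
theorem exists_low_pass : ∃ C : ℝ, 0 ≤ C ∧ ∀ (φ : 𝓢(ℝ, ℂ)) (δ : ℝ), 0 < δ →
    ∃ ρ : 𝓢(ℝ, ℂ), (∀ᶠ w in 𝓝 (0 : ℝ), 𝓕 (φ - ρ) w = 0) ∧
      ∫ t, ‖ρ t‖ ≤ C * ∫ t, ‖φ t‖ ∧ ∀ t, ‖ρ t‖ ≤ C * δ * ∫ t, ‖φ t‖ := by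
  obtain ⟨η, hη⟩ := exists_schwartz_fourier_eq_one_near_zero
  obtain ⟨S, hS, hb⟩ := η.decay 0 0
  have hb : ∀ t, ‖η t‖ ≤ S := fun t => by simpa using hb t
  have hI : 0 ≤ ∫ t, ‖η t‖ := integral_nonneg fun _ => norm_nonneg _
  refine ⟨S + ∫ t, ‖η t‖, by positivity, fun φ δ hδ => ?_⟩
  obtain ⟨g, hg, hgF⟩ := exists_schwartz_dilation η hδ
  have hφ : 0 ≤ ∫ t, ‖φ t‖ := integral_nonneg fun _ => norm_nonneg _
  have hgS : ∀ t, ‖g t‖ ≤ δ * S := fun t => by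
    rw [hg, norm_mul, Complex.norm_real, Real.norm_of_nonneg hδ.le]
    gcongr
    exact hb _
  have hgI : ∫ t, ‖g t‖ = ∫ t, ‖η t‖ := by
    simp only [hg, norm_mul, Complex.norm_real, Real.norm_of_nonneg hδ.le]
    rw [integral_const_mul, Measure.integral_comp_mul_left (fun u => ‖η u‖),
      abs_of_pos (inv_pos.2 hδ), smul_eq_mul, mul_inv_cancel_left₀ hδ.ne']
  -- Since `𝓕 g = 1` near `0`, the transform of `φ - φ * g` vanishes there. The norm bounds are the
  -- convolution estimates with the `L^1` and `L^∞` norms of `g`.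
  set ρ := SchwartzMap.convolution (ContinuousLinearMap.mul ℂ ℂ) φ g with hρ
  have hρn : ∀ t, ‖ρ t‖ ≤ ∫ s, ‖φ s‖ * ‖g (t - s)‖ := fun t => by
    rw [hρ, SchwartzMap.convolution_apply, convolution_def]
    refine (norm_integral_le_integral_norm _).trans (le_of_eq ?_)
    simp
  refine ⟨ρ, ?_, ?_, fun t => ?_⟩
  · have h1 : Tendsto (fun w : ℝ => w / δ) (𝓝 0) (𝓝 0) := by
      have : Continuous fun w : ℝ => w / δ := by fun_prop
      simpa using this.tendsto 0
    filter_upwards [h1.eventually hη] with w hw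
    have : 𝓕 (φ - ρ) = 𝓕 φ - 𝓕 ρ := map_sub (FourierTransform.fourierCLM ℂ 𝓢(ℝ, ℂ)) φ ρ
    rw [this, hρ, SchwartzMap.fourier_convolution]
    simp [SchwartzMap.pairing_apply_apply, hgF, hw]
  · calc ∫ t, ‖ρ t‖ ≤ ∫ t, ∫ s, ‖φ s‖ * ‖g (t - s)‖ := by
          refine integral_mono ρ.integrable.norm ?_ hρn
          exact φ.integrable.norm.integrable_convolution (ContinuousLinearMap.mul ℝ ℝ)
            g.integrable.norm
      _ = (∫ t, ‖φ t‖) * ∫ t, ‖g t‖ :=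
          integral_convolution (ContinuousLinearMap.mul ℝ ℝ) φ.integrable.norm g.integrable.norm
      _ ≤ (S + ∫ t, ‖η t‖) * ∫ t, ‖φ t‖ := by
          rw [hgI, mul_comm]
          gcongr
          linarith
  · calc ‖ρ t‖ ≤ ∫ s, ‖φ s‖ * ‖g (t - s)‖ := hρn t
      _ ≤ ∫ s, ‖φ s‖ * (δ * S) := by
          refine integral_mono_of_nonneg (Eventually.of_forall fun s => by positivity)
            (φ.integrable.norm.mul_const _) (Eventually.of_forall fun s => ?_)
          simp only
          gcongr
          exact hgS _
      _ = S * δ * ∫ s, ‖φ s‖ := by rw [integral_mul_const]; ring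
      _ ≤ _ := by gcongr; linarith

theorem exists_bump (c : ℝ) {h : ℝ} (hh : 0 < h) :
    ∃ (b : ℝ → ℝ) (φ : 𝓢(ℝ, ℂ)), (∀ x, φ x = b x) ∧ (∀ x, 0 ≤ b x) ∧ (∀ x, b x ≤ 1) ∧
      (∀ x, b x ≠ 0 → |x - c| < h / 2) ∧ h / 2 ≤ ∫ x, b x ∧ ∫ x, b x ≤ h := by
  let b : ContDiffBump c := ⟨h / 4, h / 2, by positivity, by linarith⟩
  have h1 : HasCompactSupport fun x : ℝ => ((b x : ℝ) : ℂ) :=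
    b.hasCompactSupport.comp_left (g := fun x : ℝ => (x : ℂ)) Complex.ofReal_zero
  have h2 : ContDiff ℝ (⊤ : ℕ∞) fun x : ℝ => ((b x : ℝ) : ℂ) :=
    Complex.ofRealCLM.contDiff.comp b.contDiff
  refine ⟨b, h1.toSchwartzMap h2, fun x => rfl, fun x => b.nonneg, fun x => b.le_one,
    fun x hx => ?_, ?_, ?_⟩
  · have : x ∈ Function.support b := hx
    rwa [b.support_eq, Metric.mem_ball, Real.dist_eq] at this
  · have := b.measure_closedBall_le_integral volume
    rw [Real.volume_real_closedBall (by positivity)] at this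
    change 2 * (h / 4) ≤ _ at this
    linarith
  · have := b.integral_le_measure_closedBall (μ := volume)
    rw [Real.volume_real_closedBall (by positivity)] at this
    change _ ≤ 2 * (h / 2) at this
    linarith

variable {E : Type*} [NormedAddCommGroup E] [NormedSpace ℂ E]

/-- The Schwartz function `t ↦ φ(t) z`. -/
def schwartzTensor (φ : 𝓢(ℝ, ℂ)) (z : E) : 𝓢(ℝ, E) :=
  φ.postcompCLM (ContinuousLinearMap.toSpanSingleton ℂ z)

@[simp]
theorem schwartzTensor_apply (φ : 𝓢(ℝ, ℂ)) (z : E) (t : ℝ) : schwartzTensor φ z t = φ t • z :=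
  rfl

theorem fourierHat_schwartzTensor [CompleteSpace E] (φ : 𝓢(ℝ, ℂ)) (z : E) (ξ : ℝ) :
    fourierHat (schwartzTensor φ z : ℝ → E) ξ = fourierHat (φ : ℝ → ℂ) ξ • z := by
  simp only [fourierHat, schwartzTensor_apply]
  rw [← integral_smul_const]
  simp only [smul_assoc]

theorem fourierHat_sum {ι : Type*} (s : Finset ι) (g : ι → 𝓢(ℝ, E)) (ξ : ℝ) :
    fourierHat ((∑ i ∈ s, g i : 𝓢(ℝ, E)) : ℝ → E) ξ =
      ∑ i ∈ s, fourierHat (g i : ℝ → E) ξ := by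
  have h : 𝓕 (∑ i ∈ s, g i) = ∑ i ∈ s, 𝓕 (g i) :=
    map_sum (FourierTransform.fourierCLM ℂ 𝓢(ℝ, E)) g s
  simp only [fourierHat_schwartz, h, sum_apply]

theorem mem_homSchwartz_of_eventuallyEq_zero {f : 𝓢(ℝ, E)}
    (hf : fourierHat (f : ℝ → E) =ᶠ[𝓝 0] fun _ => 0) : f ∈ homSchwartz E := by
  intro k
  rw [hf.iteratedDeriv_eq k]
  exact iteratedDeriv_fun_const_zero

theorem schwartzTensor_mem_homSchwartz [CompleteSpace E] {φ : 𝓢(ℝ, ℂ)}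
    (hφ : ∀ᶠ w in 𝓝 (0 : ℝ), 𝓕 φ w = 0) (z : E) : schwartzTensor φ z ∈ homSchwartz E := by
  refine mem_homSchwartz_of_eventuallyEq_zero ?_
  have h1 : Tendsto (fun ξ : ℝ => (2 * Real.pi)⁻¹ * ξ) (𝓝 0) (𝓝 0) := by
    have : Continuous fun ξ : ℝ => (2 * Real.pi)⁻¹ * ξ := by fun_prop
    simpa using this.tendsto 0
  filter_upwards [h1.eventually hφ] with ξ hξ
  rw [fourierHat_schwartzTensor, fourierHat_schwartz]
  simp only [hξ, zero_smul]

theorem sum_mem_homSchwartz {ι : Type*} (s : Finset ι) {g : ι → 𝓢(ℝ, E)}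
    (hg : ∀ i ∈ s, g i ∈ homSchwartz E) : ∑ i ∈ s, g i ∈ homSchwartz E := by
  induction s using Finset.cons_induction with
  | empty =>
    rw [mem_homSchwartz_iff]
    intro k
    have : 𝓕 (∑ i ∈ (∅ : Finset ι), g i) = 0 := by
      rw [Finset.sum_empty]; exact map_zero (FourierTransform.fourierCLM ℂ 𝓢(ℝ, E))
    rw [this]
    exact iteratedDeriv_fun_const_zero
  | cons i s hi ih =>
    rw [Finset.sum_cons, mem_homSchwartz_iff]
    intro k
    have h1 : 𝓕 (g i + ∑ j ∈ s, g j) = 𝓕 (g i) + 𝓕 (∑ j ∈ s, g j) :=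
      map_add (FourierTransform.fourierCLM ℂ 𝓢(ℝ, E)) _ _
    have h2 := (mem_homSchwartz_iff _).1 (hg i (Finset.mem_cons_self i s)) k
    have h3 := (mem_homSchwartz_iff _).1 (ih fun j hj => hg j (Finset.mem_cons_of_mem hj)) k
    have h4 : ((𝓕 (g i) + 𝓕 (∑ j ∈ s, g j) : 𝓢(ℝ, E)) : ℝ → E) =
      ((𝓕 (g i) : 𝓢(ℝ, E)) : ℝ → E) + ((𝓕 (∑ j ∈ s, g j) : 𝓢(ℝ, E)) : ℝ → E) := rfl
    rw [h1, h4, iteratedDeriv_add ((𝓕 (g i)).smooth k).contDiffAt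
      ((𝓕 (∑ j ∈ s, g j)).smooth k).contDiffAt, h2, h3, add_zero]

end TestFunctions

/-! ### Consequences of the cut-off multiplier bounds. -/

section MultipliersToStability

/-- Interpolation through `|f|^p ≤ B^(p-1) |f|`. It makes the test-function estimates independent of
the unknown exponent `p`. -/
theorem eLpNorm_le_of_eLpNorm_one_le {E : Type*} [NormedAddCommGroup E] {f : ℝ → E} {B : ℝ≥0}
    (hB : ∀ x, ‖f x‖ₑ ≤ B) (h1 : eLpNorm f 1 volume ≤ B) {p : ℝ≥0∞} (hp : 1 ≤ p) :
    eLpNorm f p volume ≤ B := by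
  rcases eq_or_ne p ∞ with rfl | hp'
  · rw [eLpNorm_exponent_top]
    exact essSup_le_of_ae_le _ (Eventually.of_forall hB)
  have hP : 1 ≤ p.toReal := by
    rw [← ENNReal.toReal_one]; exact ENNReal.toReal_mono hp' hp
  rw [eLpNorm_eq_lintegral_rpow_enorm_toReal (zero_lt_one.trans_le hp).ne' hp']
  rw [eLpNorm_one_eq_lintegral_enorm] at h1
  have h2 : ∫⁻ x, ‖f x‖ₑ ^ p.toReal ≤ (B : ℝ≥0∞) ^ p.toReal := by
    calc ∫⁻ x, ‖f x‖ₑ ^ p.toReal ≤ ∫⁻ x, (B : ℝ≥0∞) ^ (p.toReal - 1) * ‖f x‖ₑ := by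
          refine lintegral_mono fun x => ?_
          calc ‖f x‖ₑ ^ p.toReal = ‖f x‖ₑ ^ (p.toReal - 1) * ‖f x‖ₑ := by
                conv_rhs => rw [← ENNReal.rpow_one ‖f x‖ₑ, ← ENNReal.rpow_mul, one_mul,
                  ← ENNReal.rpow_add_of_nonneg _ _ (sub_nonneg.2 hP) zero_le_one, sub_add_cancel]
            _ ≤ _ := by
                exact mul_le_mul' (ENNReal.rpow_le_rpow (hB x) (sub_nonneg.2 hP)) le_rfl
      _ = (B : ℝ≥0∞) ^ (p.toReal - 1) * ∫⁻ x, ‖f x‖ₑ :=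
          lintegral_const_mul' _ _ (ENNReal.rpow_ne_top_of_nonneg (sub_nonneg.2 hP)
            ENNReal.coe_ne_top)
      _ ≤ (B : ℝ≥0∞) ^ (p.toReal - 1) * B := by gcongr
      _ = _ := by
          conv_lhs => rw [← ENNReal.rpow_one (B : ℝ≥0∞), ← ENNReal.rpow_mul, one_mul,
            ← ENNReal.rpow_add_of_nonneg _ _ (sub_nonneg.2 hP) zero_le_one, sub_add_cancel]
  calc _ ≤ ((B : ℝ≥0∞) ^ p.toReal) ^ (1 / p.toReal) := by gcongr
    _ = B := by
      rw [← ENNReal.rpow_mul, mul_one_div_cancel (by linarith), ENNReal.rpow_one]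

variable {E F : Type*} [NormedAddCommGroup E] [NormedSpace ℂ E]
  [NormedAddCommGroup F] [NormedSpace ℂ F]

theorem norm_exp_smul (ξ t : ℝ) (v : F) : ‖Complex.exp (Complex.I * ξ * t) • v‖ = ‖v‖ := by
  rw [norm_smul, norm_exp_I_mul_mul, one_mul]

theorem integrable_exp_smul {g : ℝ → F} (hg : Integrable g) (t : ℝ) :
    Integrable fun ξ : ℝ => Complex.exp (Complex.I * ξ * t) • g ξ := by
  refine hg.norm.mono' ((by fun_prop : Continuous fun ξ : ℝ =>
    Complex.exp (Complex.I * ξ * t)).aestronglyMeasurable.smul hg.1) (Eventually.of_forall fun ξ => ?_)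
  rw [norm_exp_smul]

theorem continuous_multiplierOp {m : ℝ → E →L[ℂ] F} {f : 𝓢(ℝ, E)}
    (hm : Integrable fun ξ => m ξ (fourierHat (f : ℝ → E) ξ)) : Continuous (multiplierOp m f) := by
  refine continuous_const.smul ?_
  refine continuous_of_dominated (fun t => (integrable_exp_smul hm t).1)
    (fun t => Eventually.of_forall fun ξ => (norm_exp_smul ξ t _).le) hm.norm
    (Eventually.of_forall fun ξ => ?_)
  fun_prop

theorem integrable_smul_symbol {m : ℝ → E →L[ℂ] F} {f : 𝓢(ℝ, E)}
    (hm : Integrable fun ξ => m ξ (fourierHat (f : ℝ → E) ξ)) {ψ : ℝ → ℂ} (hψ : Continuous ψ)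
    {C : ℝ} (hC : ∀ ξ, ‖ψ ξ‖ ≤ C) :
    Integrable fun ξ => (ψ ξ • m ξ) (fourierHat (f : ℝ → E) ξ) := by
  exact hm.bdd_smul C hψ.aestronglyMeasurable (Eventually.of_forall hC)

theorem multiplierOp_eq_add {m : ℝ → E →L[ℂ] F} {f : 𝓢(ℝ, E)} {ψ : ℝ → ℂ}
    (h1 : Integrable fun ξ => (ψ ξ • m ξ) (fourierHat (f : ℝ → E) ξ))
    (h2 : Integrable fun ξ => ((1 - ψ ξ) • m ξ) (fourierHat (f : ℝ → E) ξ)) (t : ℝ) :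
    multiplierOp m f t = multiplierOp (fun ξ => ψ ξ • m ξ) f t +
      multiplierOp (fun ξ => (1 - ψ ξ) • m ξ) f t := by
  rw [multiplierOp, multiplierOp, multiplierOp, ← smul_add,
    ← integral_add (integrable_exp_smul h1 t) (integrable_exp_smul h2 t)]
  congr with ξ
  rw [← smul_add, ← add_apply, ← add_smul, add_sub_cancel, one_smul]

theorem multiplierOp_sum {m : ℝ → E →L[ℂ] F} {ι : Type*} (s : Finset ι) {g : ι → 𝓢(ℝ, E)}
    (hm : ∀ i ∈ s, Integrable fun ξ => m ξ (fourierHat (g i : ℝ → E) ξ)) (t : ℝ) :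
    multiplierOp m (∑ i ∈ s, g i) t = ∑ i ∈ s, multiplierOp m (g i) t := by
  simp only [multiplierOp, fourierHat_sum, map_sum, Finset.smul_sum]
  rw [integral_finsetSum s fun i hi => integrable_exp_smul (hm i hi) t, Finset.smul_sum]

/-- If both parts of a symbol, cut off by a smooth function, are Fourier multipliers, then the
minimum of `‖T_m f‖` over intervals of length one is controlled. -/
theorem exists_le_of_cutoff_multipliers {m : ℝ → E →L[ℂ] F}
    (hm : ∀ f ∈ homSchwartz E, Integrable fun ξ => m ξ (fourierHat (f : ℝ → E) ξ))
    {ψ : ℝ → ℂ} (hψ : Continuous ψ) (hψc : HasCompactSupport ψ) {p q : ℝ≥0∞} (hp : 1 ≤ p)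
    (hpq : p ≤ q) (h1 : IsFourierMultiplier 1 ∞ (fun ξ => ψ ξ • m ξ))
    (h2 : IsFourierMultiplier p q (fun ξ => (1 - ψ ξ) • m ξ)) :
    ∃ D : ℝ≥0, ∀ f ∈ homSchwartz E, ∀ B : ℝ≥0, (∀ t, ‖f t‖ₑ ≤ B) → eLpNorm f 1 volume ≤ B →
      ∀ (a : ℝ) (L : ℝ≥0), (∀ t ∈ Icc a (a + 1), L ≤ ‖multiplierOp m f (-t)‖ₑ) → L ≤ D * B := by
  obtain ⟨C₁, hC₁⟩ := h1.bounded
  obtain ⟨C₂, hC₂⟩ := h2.bounded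
  obtain ⟨S, hS⟩ := hψ.bounded_above_of_compact_support hψc
  refine ⟨C₁ + C₂, fun f hf B hB hB1 a L hL => ?_⟩
  have i1 := integrable_smul_symbol (hm f hf) hψ hS
  have i2 := integrable_smul_symbol (hm f hf) (ψ := fun ξ => 1 - ψ ξ) (by fun_prop)
    (C := 1 + S) fun ξ => (norm_sub_le _ _).trans (by rw [norm_one]; gcongr; exact hS ξ)
  have c1 := continuous_multiplierOp (m := fun ξ => ψ ξ • m ξ) i1
  have c2 := continuous_multiplierOp (m := fun ξ => (1 - ψ ξ) • m ξ) i2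
  set g₁ := multiplierOp (fun ξ => ψ ξ • m ξ) f
  set g₂ := multiplierOp (fun ξ => (1 - ψ ξ) • m ξ) f
  -- A probability measure, so the `L^∞` norm of one part and the `L^q` norm of the other both
  -- dominate the `L^1` average. The interval is reflected because the lower bound concerns the
  -- values at `-t`.
  set μ : Measure ℝ := volume.restrict (Icc (-(a + 1)) (-a)) with hμ
  have : IsProbabilityMeasure μ := ⟨by rw [hμ, Measure.restrict_apply_univ, Real.volume_Icc]; simp⟩
  have e1 : ∫⁻ t, ‖g₁ t‖ₑ ∂μ ≤ C₁ * B := by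
    rw [← eLpNorm_one_eq_lintegral_enorm]
    calc _ ≤ eLpNorm g₁ ∞ μ := eLpNorm_le_eLpNorm_of_exponent_le le_top c1.aestronglyMeasurable
      _ ≤ eLpNorm g₁ ∞ volume := eLpNorm_mono_measure _ Measure.restrict_le_self
      _ ≤ C₁ * eLpNorm f 1 volume := hC₁ f hf
      _ ≤ C₁ * B := by gcongr
  have e2 : ∫⁻ t, ‖g₂ t‖ₑ ∂μ ≤ C₂ * B := by
    rw [← eLpNorm_one_eq_lintegral_enorm]
    calc _ ≤ eLpNorm g₂ q μ :=
          eLpNorm_le_eLpNorm_of_exponent_le (hp.trans hpq) c2.aestronglyMeasurable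
      _ ≤ eLpNorm g₂ q volume := eLpNorm_mono_measure _ Measure.restrict_le_self
      _ ≤ C₂ * eLpNorm f p volume := hC₂ f hf
      _ ≤ C₂ * B := by gcongr; exact eLpNorm_le_of_eLpNorm_one_le hB hB1 hp
  have e3 : (L : ℝ≥0∞) ≤ (C₁ + C₂ : ℝ≥0) * B := by
    calc (L : ℝ≥0∞) = ∫⁻ _, L ∂μ := by simp
      _ ≤ ∫⁻ t, (‖g₁ t‖ₑ + ‖g₂ t‖ₑ) ∂μ := by
          refine setLIntegral_mono' measurableSet_Icc fun t ht => ?_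
          have h3 := hL (-t) ⟨by linarith [ht.2], by linarith [ht.1]⟩
          rw [neg_neg, multiplierOp_eq_add i1 i2] at h3
          exact h3.trans (enorm_add_le _ _)
      _ = (∫⁻ t, ‖g₁ t‖ₑ ∂μ) + ∫⁻ t, ‖g₂ t‖ₑ ∂μ := lintegral_add_left c1.enorm.measurable _
      _ ≤ C₁ * B + C₂ * B := add_le_add e1 e2
      _ = _ := by push_cast; ring
  exact_mod_cast e3

variable {X : Type*} [NormedAddCommGroup X] [NormedSpace ℂ X] [CompleteSpace X]
  {Y : Type*} [NormedAddCommGroup Y] [NormedSpace ℂ Y] [CompleteSpace Y] {T : ℝ → X →L[ℂ] X}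

/-- Integrability of the weighted orbit of `z` makes the Laplace formula valid on the imaginary axis
away from `0`. No regularisation is needed, and the transform of `φ` need not vanish at `0`. -/
theorem multiplierOp_resolventPow_schwartzTensor (hT : IsC0Semigroup T) {A : X →ₗ.[ℂ] X}
    (hA : IsGenerator (-A) T) {α β : ℝ} (h : HasResolventGrowth A α β) {ι : Y →L[ℂ] X} {n : ℕ}
    {z : Y} (hz : IntegrableOn (fun s : ℝ => s ^ n • T s (ι z)) (Ioi 0)) (φ : 𝓢(ℝ, ℂ)) (t : ℝ) :
    multiplierOp (resolventPow A ι (n + 1)) (schwartzTensor φ z) t =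
      ((-1) ^ (n + 1) * (n.factorial : ℝ)⁻¹) •
        ∫ s in Ioi (0 : ℝ), φ (t + s) • s ^ n • T s (ι z) := by
  have hmax : ∀ {s : ℝ}, s ∈ Ioi (0 : ℝ) → max s 0 = s := fun hs => max_eq_left (mem_Ioi.1 hs).le
  set k : ℝ → X := fun s => s ^ n • T (max s 0) (ι z) with hk
  have hkc : Continuous k := (continuous_pow n).smul (hT.continuous_orbit _)
  have hke : EqOn (fun s : ℝ => s ^ n • T s (ι z)) k (Ioi 0) := fun s hs => by
    simp only [hk, hmax hs]
  have hki : IntegrableOn k (Ioi 0) := hz.congr_fun hke measurableSet_Ioi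
  -- The orbit is viewed as a kernel from `ℂ` to `X` acting on the scalar function `φ`, so that only
  -- the norm of this one orbit has to be integrable.
  set K : ℝ → ℂ →L[ℂ] X := fun s => ContinuousLinearMap.toSpanSingleton ℂ (k s) with hK
  have hKc : Continuous fun p : ℝ × ℂ => K p.1 p.2 := by
    simp only [hK, ContinuousLinearMap.toSpanSingleton_apply]
    fun_prop
  have hker := integral_symbol_eq_integral_kernel φ hKc hki.norm
    (fun s _ => (ContinuousLinearMap.norm_toSpanSingleton (𝕜 := ℂ) (k s)).le) t
  have e1 : ∫ s in Ioi (0 : ℝ), φ (t + s) • s ^ n • T s (ι z) =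
      ∫ s in Ioi (0 : ℝ), K s (φ (t + s)) :=
    setIntegral_congr_fun measurableSet_Ioi fun s hs => by
      simp only [hK, ContinuousLinearMap.toSpanSingleton_apply, ← hke hs]
  rw [e1, ← hker, smul_comm, multiplierOp]
  congr 1
  rw [← integral_smul]
  refine integral_congr_ae ?_
  filter_upwards [compl_mem_ae_iff.2 (measure_singleton (0 : ℝ))] with ξ hξ
  rw [smul_comm]
  congr 1
  have hR : IsResolventAt A (-(-(Complex.I * ξ))) (opResolvent A (Complex.I * ξ)) := by
    rw [neg_neg]
    have := isResolventAt_opResolvent (h.mem_opResolventSet le_rfl hξ)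
    simpa using this
  have hTi : ∀ i ≤ n, IntegrableOn
      (fun s : ℝ => s ^ i • Complex.exp (-(-(Complex.I * ξ) * s)) • T s (ι z)) (Ioi 0) := by
    intro i hi
    have h1 : IntegrableOn (fun s : ℝ => s ^ i • T (max s 0) (ι z)) (Ioi 0) :=
      integrableOn_pow_smul_of_le (hT.continuous_orbit _) hi hki
    have h2 : IntegrableOn (fun s : ℝ => Complex.exp (-(-(Complex.I * ξ) * s)) •
        s ^ i • T (max s 0) (ι z)) (Ioi 0) := by
      refine h1.norm.mono' ((by fun_prop : Continuous fun s : ℝ =>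
        Complex.exp (-(-(Complex.I * ξ) * s))).aestronglyMeasurable.smul h1.1)
        (Eventually.of_forall fun s => ?_)
      rw [neg_mul, neg_neg, norm_exp_smul]
    exact h2.congr_fun (fun s hs => by simp only [hmax hs]; rw [smul_comm]) measurableSet_Ioi
  rw [fourierHat_schwartzTensor, map_smul, resolventPow, ContinuousLinearMap.comp_apply,
    hT.resolvent_pow_eq_laplace hA hR hTi n le_rfl, smul_comm]
  congr 1
  rw [← integral_smul]
  refine setIntegral_congr_fun measurableSet_Ioi fun s hs => ?_
  simp only [hK, ContinuousLinearMap.toSpanSingleton_apply, ← hke hs, neg_mul, neg_neg]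
  rw [smul_comm, smul_comm (s ^ n), smul_comm (s ^ n)]
  exact smul_comm _ _ _

end MultipliersToStability

/-! ### Averages of orbits against bump functions. -/

section LowerBound

theorem norm_integral_smul_sub_le {E : Type*} [NormedAddCommGroup E] [NormedSpace ℝ E]
    [CompleteSpace E] {μ : Measure ℝ} {w : ℝ → ℝ} {g : ℝ → E} {v : E} {ε : ℝ}
    (hw : Integrable w μ) (hwg : Integrable (fun s => w s • g s) μ)
    (h0 : ∀ᵐ s ∂μ, 0 ≤ w s) (h : ∀ᵐ s ∂μ, w s ≠ 0 → ‖g s - v‖ ≤ ε) :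
    ‖∫ s, w s • g s ∂μ - (∫ s, w s ∂μ) • v‖ ≤ ε * ∫ s, w s ∂μ := by
  rw [← integral_smul_const, ← integral_sub hwg (hw.smul_const v), ← integral_const_mul]
  refine norm_integral_le_of_norm_le (hw.const_mul ε) ?_
  filter_upwards [h0, h] with s hs0 hs
  rw [← smul_sub, norm_smul, Real.norm_of_nonneg hs0, mul_comm]
  rcases eq_or_ne (w s) 0 with h1 | h1
  · simp [h1]
  · gcongr
    exact hs h1

variable {X : Type*} [NormedAddCommGroup X] [NormedSpace ℂ X] [CompleteSpace X]
  {T : ℝ → X →L[ℂ] X}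

omit [CompleteSpace X] in
theorem IsC0Semigroup.integrableOn_pow_smul_map (hT : IsC0Semigroup T) {n : ℕ} {x : X}
    (hx : IntegrableOn (fun s : ℝ => s ^ n • T s x) (Ioi 0)) {r : ℝ} (hr : 0 ≤ r) :
    IntegrableOn (fun s : ℝ => s ^ n • T s (T r x)) (Ioi 0) := by
  refine IntegrableOn.congr_fun ((T r).integrable_comp hx) (fun s hs => ?_) measurableSet_Ioi
  rw [ContinuousLinearMap.map_smul_of_tower, ← ContinuousLinearMap.comp_apply,
    ← ContinuousLinearMap.comp_apply, ← hT.map_add _ _ hr (mem_Ioi.1 hs).le,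
    ← hT.map_add _ _ (mem_Ioi.1 hs).le hr, add_comm]

theorem integrableOn_schwartz_smul {E : Type*} [NormedAddCommGroup E] [NormedSpace ℂ E]
    (φ : 𝓢(ℝ, ℂ)) {g : ℝ → E} {s : Set ℝ} (hg : IntegrableOn g s) (t : ℝ) :
    IntegrableOn (fun r => φ (t + r) • g r) s := by
  obtain ⟨C, -, hC⟩ := φ.decay 0 0
  exact hg.bdd_smul C (φ.continuous.comp (by fun_prop)).aestronglyMeasurable
    (Eventually.of_forall fun r => by simpa using hC (t + r))

/-- The average of the weighted orbit against a bump function supported in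
`(τ - r - h, τ - r)`. -/
theorem IsC0Semigroup.exists_weight_of_bump (hT : IsC0Semigroup T) {n : ℕ} {x : X}
    (hx : IntegrableOn (fun s : ℝ => s ^ n • T s x) (Ioi 0)) {τ r h ε a : ℝ} (ha : 1 ≤ a)
    (hr : 0 ≤ r) (hτ : a ≤ τ - r - h)
    (hε : ∀ u : ℝ, u ≤ τ → τ - h ≤ u → ‖T u x - T τ x‖ ≤ ε) {b : ℝ → ℝ} {φ : 𝓢(ℝ, ℂ)}
    (hφ : ∀ s, φ s = b s) (hb0 : ∀ s, 0 ≤ b s)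
    (hbs : ∀ s, b s ≠ 0 → |s - -(r + h / 2)| < h / 2) (hb : h / 2 ≤ ∫ s, b s) :
    ∃ W : ℝ, a ^ n * (h / 2) ≤ W ∧
      ‖(∫ s in Ioi (0 : ℝ), φ (-τ + s) • s ^ n • T s (T r x)) - W • T τ x‖ ≤ ε * W := by
  -- On the support `s + r` lies in `(τ - h, τ)`, so `T s (T r x)` is within `ε` of `T τ x`. Also `s
  -- ≥ a` there, which bounds the weight `s ^ n` from below.
  have hsupp : ∀ s, b (-τ + s) ≠ 0 → τ - r - h < s ∧ s < τ - r := fun s hs => by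
    have := abs_lt.1 (hbs _ hs)
    constructor <;> linarith
  have hbre : b = fun s => (φ s).re := by ext s; rw [hφ, Complex.ofReal_re]
  have hbi : Integrable b := by rw [hbre]; exact φ.integrable.re
  have hbc : Continuous b := by rw [hbre]; exact Complex.continuous_re.comp φ.continuous
  have hbi' : Integrable fun s => b (-τ + s) := hbi.comp_add_left (-τ)
  set w : ℝ → ℝ := fun s => b (-τ + s) * s ^ n with hw
  have hwi : IntegrableOn w (Ioi 0) := by
    refine (hbi'.integrableOn.const_mul (τ ^ n)).mono'
      (by fun_prop : Continuous w).aestronglyMeasurable ?_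
    filter_upwards [ae_restrict_mem measurableSet_Ioi] with s hs
    have hs0 : 0 < s := hs
    rw [hw]
    simp only
    rw [Real.norm_of_nonneg (mul_nonneg (hb0 _) (by positivity)), mul_comm]
    rcases eq_or_ne (b (-τ + s)) 0 with h0 | h0
    · simp [h0]
    · gcongr
      · exact hb0 _
      · linarith [(hsupp s h0).2]
  have heq : ∀ s, φ (-τ + s) • s ^ n • T s (T r x) = w s • T s (T r x) := fun s => by
    rw [hφ, Complex.coe_smul, smul_smul]
  simp only [heq]
  refine ⟨∫ s in Ioi (0 : ℝ), w s, ?_, norm_integral_smul_sub_le hwi ?_ ?_ ?_⟩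
  · calc a ^ n * (h / 2) ≤ a ^ n * ∫ s, b s := by gcongr
      _ = ∫ s, a ^ n * b (-τ + s) := by
          rw [integral_const_mul, integral_add_left_eq_self (fun s => b s) (-τ)]
      _ = ∫ s in Ioi (0 : ℝ), a ^ n * b (-τ + s) := by
          refine (setIntegral_eq_integral_of_forall_compl_eq_zero fun s hs => ?_).symm
          by_contra h0
          have := hsupp s (right_ne_zero_of_mul h0)
          exact hs (mem_Ioi.2 (by linarith))
      _ ≤ ∫ s in Ioi (0 : ℝ), w s := by
          refine setIntegral_mono_on (hbi'.integrableOn.const_mul _) hwi measurableSet_Ioi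
            fun s _ => ?_
          simp only [hw]
          rw [mul_comm]
          rcases eq_or_ne (b (-τ + s)) 0 with h0 | h0
          · simp [h0]
          · gcongr
            · exact hb0 _
            · linarith [(hsupp s h0).1]
  · have := integrableOn_schwartz_smul φ (hT.integrableOn_pow_smul_map hx hr) (-τ)
    simp only [heq] at this
    exact this
  · filter_upwards [ae_restrict_mem measurableSet_Ioi] with s hs
    have hs0 : 0 < s := hs
    exact mul_nonneg (hb0 _) (by positivity)
  · filter_upwards [ae_restrict_mem measurableSet_Ioi] with s hs h0
    have := hsupp s (left_ne_zero_of_mul h0)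
    rw [← ContinuousLinearMap.comp_apply, ← hT.map_add _ _ (mem_Ioi.1 hs).le hr]
    exact hε _ (by linarith) (by linarith)

/-- The centres are `h` apart and the supports have radius `h / 2`, so at most one summand is
nonzero at each point. -/
theorem sum_bump_le_one {N : ℕ} {h : ℝ} (hh : 0 < h) {b : ℕ → ℝ → ℝ} (hb1 : ∀ j s, b j s ≤ 1)
    (hbs : ∀ j s, b j s ≠ 0 → |s - -(j * h + h / 2)| < h / 2) (s : ℝ) :
    ∑ j ∈ Finset.range N, b j s ≤ 1 := by
  by_cases H : ∃ i ∈ Finset.range N, b i s ≠ 0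
  · obtain ⟨i, hi, hi0⟩ := H
    rw [Finset.sum_eq_single_of_mem i hi]
    · exact hb1 i s
    · intro j _ hji
      by_contra hj0
      have h1 := abs_lt.1 (hbs i s hi0)
      have h2 := abs_lt.1 (hbs j s hj0)
      have h3 : ((j : ℝ) - i) * h < 1 * h := by linarith
      have h4 : ((i : ℝ) - j) * h < 1 * h := by linarith
      have h5 : (j : ℝ) < i + 1 := by linarith [lt_of_mul_lt_mul_right h3 hh.le]
      have h6 : (i : ℝ) < j + 1 := by linarith [lt_of_mul_lt_mul_right h4 hh.le]
      have h5' : j < i + 1 := by exact_mod_cast h5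
      have h6' : i < j + 1 := by exact_mod_cast h6
      omega
  · push Not at H
    rw [Finset.sum_eq_zero H]
    exact zero_le_one

end LowerBound

/-! ### The multiplier bounds imply stability. -/

section MultipliersImplyStability

open scoped FourierTransform

/-- The bumps do not overlap, and the `N` corrections cost at most `C * h` each with `N * h = 1`.
Hence the bounds do not depend on the mesh, which will be refined freely. -/
theorem sum_schwartzTensor_bounds {E : Type*} [NormedAddCommGroup E] [NormedSpace ℂ E]
    {N : ℕ} {h C K : ℝ} (hh : 0 < h) (hNh : N * h = 1) (hK : 0 ≤ K)
    {b : ℕ → ℝ → ℝ} {φ ρ : ℕ → 𝓢(ℝ, ℂ)} (hφ : ∀ j s, φ j s = b j s) (hb0 : ∀ j s, 0 ≤ b j s)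
    (hb1 : ∀ j s, b j s ≤ 1) (hbs : ∀ j s, b j s ≠ 0 → |s - -(j * h + h / 2)| < h / 2)
    (hbi : ∀ j, ∫ s, b j s ≤ h) (hρ : ∀ j s, ‖ρ j s‖ ≤ C * h) (hρi : ∀ j, ∫ s, ‖ρ j s‖ ≤ C * h)
    {z : ℕ → E} (hz : ∀ j ∈ Finset.range N, ‖z j‖ ≤ K) :
    (∀ t, ‖(∑ j ∈ Finset.range N, schwartzTensor (φ j - ρ j) (z j)) t‖ ≤ K * (1 + C)) ∧
    ∫ t, ‖(∑ j ∈ Finset.range N, schwartzTensor (φ j - ρ j) (z j)) t‖ ≤ K * (1 + C) := by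
  have hpt : ∀ t, ‖(∑ j ∈ Finset.range N, schwartzTensor (φ j - ρ j) (z j)) t‖ ≤
      ∑ j ∈ Finset.range N, K * (b j t + ‖ρ j t‖) := by
    intro t
    rw [sum_apply]
    refine norm_sum_le_of_le _ fun j hj => ?_
    rw [schwartzTensor_apply, norm_smul, mul_comm]
    have h1 : ‖(φ j - ρ j) t‖ ≤ b j t + ‖ρ j t‖ := by
      rw [sub_apply, hφ]
      refine (norm_sub_le _ _).trans ?_
      rw [Complex.norm_real, Real.norm_of_nonneg (hb0 j t)]
    gcongr
    exact hz j hj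
  constructor
  · intro t
    refine (hpt t).trans ?_
    rw [← Finset.mul_sum, Finset.sum_add_distrib]
    gcongr
    · exact sum_bump_le_one hh hb1 hbs t
    · calc ∑ j ∈ Finset.range N, ‖ρ j t‖ ≤ ∑ _j ∈ Finset.range N, C * h :=
            Finset.sum_le_sum fun j _ => hρ j t
        _ = C * (N * h) := by rw [Finset.sum_const, Finset.card_range, nsmul_eq_mul]; ring
        _ = C := by rw [hNh, mul_one]
  · have hbint : ∀ j, Integrable (b j) := fun j => by
      have : b j = fun s => (φ j s).re := by ext s; rw [hφ, Complex.ofReal_re]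
      rw [this]; exact (φ j).integrable.re
    have hint : ∀ j ∈ Finset.range N, Integrable fun t => K * (b j t + ‖ρ j t‖) := fun j _ =>
      ((hbint j).add (ρ j).integrable.norm).const_mul K
    calc ∫ t, ‖(∑ j ∈ Finset.range N, schwartzTensor (φ j - ρ j) (z j)) t‖
        ≤ ∫ t, ∑ j ∈ Finset.range N, K * (b j t + ‖ρ j t‖) :=
          integral_mono (SchwartzMap.integrable _).norm (integrable_finsetSum _ hint) hpt
      _ = ∑ j ∈ Finset.range N, K * ((∫ t, b j t) + ∫ t, ‖ρ j t‖) := by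
          rw [integral_finsetSum _ hint]
          refine Finset.sum_congr rfl fun j _ => ?_
          rw [integral_const_mul, integral_add (hbint j) (ρ j).integrable.norm]
      _ ≤ ∑ _j ∈ Finset.range N, K * (h + C * h) :=
          Finset.sum_le_sum fun j _ =>
            mul_le_mul_of_nonneg_left (add_le_add (hbi j) (hρi j)) hK
      _ = K * (1 + C) * (N * h) := by
          rw [Finset.sum_const, Finset.card_range, nsmul_eq_mul]; ring
      _ = K * (1 + C) := by rw [hNh, mul_one]

variable {X : Type*} [NormedAddCommGroup X] [NormedSpace ℂ X] [CompleteSpace X]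
  {Y : Type*} [NormedAddCommGroup Y] [NormedSpace ℂ Y] [CompleteSpace Y] {T : ℝ → X →L[ℂ] X}

/-- Approximate lower bound for `‖T_m f‖` on a unit interval, for a test function `f` built from
the orbit of `y`. -/
theorem exists_test_function (hT : IsC0Semigroup T) {A : X →ₗ.[ℂ] X}
    (hA : IsGenerator (-A) T) {α β : ℝ} (hα : 0 ≤ α) (h : HasResolventGrowth A α β)
    {ι : Y →L[ℂ] X} {n : ℕ} (hι : IsAdmissible T n ι) :
    ∃ C : ℝ≥0, ∀ y : Y, IntegrableOn (fun s : ℝ => s ^ n • T s (ι y)) (Ioi 0) →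
      ∀ a : ℝ, 2 ≤ a → ∀ ε : ℝ, 0 < ε → ∃ f ∈ homSchwartz Y,
        (∀ t, ‖f t‖ ≤ C * ‖y‖) ∧ ∫ t, ‖f t‖ ≤ C * ‖y‖ ∧
        ∀ τ ∈ Icc a (a + 1), (n.factorial : ℝ)⁻¹ * ((a - 1) ^ n / 2 * (‖T τ (ι y)‖ - ε) - ε) ≤
          ‖multiplierOp (resolventPow A ι (n + 1)) f (-τ)‖ := by
  obtain ⟨C₀, hC₀, hlow⟩ := exists_low_pass
  obtain ⟨C₁, hC₁, hinv⟩ := hι.invariant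
  obtain ⟨M, hM, hMb⟩ := hT.exists_bound 1
  have hM0 : 0 ≤ M := by linarith
  refine ⟨⟨C₁ * M * (1 + C₀), by positivity⟩, fun y hy a ha ε hε => ?_⟩
  set x := ι y with hx
  have huc : UniformContinuousOn (fun t : ℝ => T (max t 0) x) (Icc 0 (a + 1)) :=
    isCompact_Icc.uniformContinuousOn_of_continuous (hT.continuous_orbit x).continuousOn
  -- The mesh `η = 1 / N` is taken below this modulus of continuity of the orbit in `X`, so that on
  -- each cell the orbit is constant up to `ε`.
  obtain ⟨δ₀, hδ₀, huc⟩ := Metric.uniformContinuousOn_iff.1 huc ε hε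
  obtain ⟨N', hN'⟩ := exists_nat_one_div_lt hδ₀
  set N := N' + 1 with hN
  set η : ℝ := 1 / ((N' : ℝ) + 1) with hη
  have hη0 : 0 < η := by positivity
  have hNη : (N : ℝ) * η = 1 := by
    rw [hN, hη]; push_cast; field_simp
  have hη1 : η ≤ 1 := by
    rw [← hNη]
    exact le_mul_of_one_le_left hη0.le (by rw [hN]; push_cast; linarith [N'.cast_nonneg (α := ℝ)])
  have hjη : ∀ j ∈ Finset.range N, (j : ℝ) * η + η ≤ 1 := by
    intro j hj
    have : (j : ℝ) + 1 ≤ N := by exact_mod_cast Finset.mem_range.1 hj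
    rw [← hNη]
    nlinarith
  have hj0 : ∀ j : ℕ, 0 ≤ (j : ℝ) * η := fun j => by positivity
  -- Admissibility gives no continuity of the orbit in the norm of `Y`. Sampling it at finitely many
  -- times avoids the question, since only the norm bound in `Y` is used.
  choose z hz hzn using fun j : ℕ => hinv (j * η) (hj0 j) y
  have hzK : ∀ j ∈ Finset.range N, ‖z j‖ ≤ C₁ * M * ‖y‖ := fun j hj =>
    (hzn j).trans (by gcongr; exact hMb _ ⟨hj0 j, by linarith [hjη j hj]⟩)
  have hzi : ∀ j, IntegrableOn (fun s : ℝ => s ^ n • T s (ι (z j))) (Ioi 0) := fun j => by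
    rw [hz]; exact hT.integrableOn_pow_smul_map hy (hj0 j)
  choose b φ hφ hb0 hb1 hbs hblow hbup using fun j : ℕ => exists_bump (-(j * η + η / 2)) hη0
  have hφi : ∀ j, ∫ t, ‖φ j t‖ ≤ η := fun j => by
    refine le_trans (le_of_eq (integral_congr_ae (Eventually.of_forall fun t => ?_))) (hbup j)
    simp only
    rw [hφ, Complex.norm_real, Real.norm_of_nonneg (hb0 j t)]
  set κ : ℕ → ℝ := fun j => ∫ s in Ioi (0 : ℝ), ‖s ^ n • T s (ι (z j))‖ with hκ
  have hκ0 : ∀ j, 0 ≤ κ j := fun j => integral_nonneg fun _ => norm_nonneg _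
  set σ : ℝ := ∑ j ∈ Finset.range N, C₀ * η * κ j with hσ
  have hσ0 : 0 ≤ σ := Finset.sum_nonneg fun j _ => mul_nonneg (by positivity) (hκ0 j)
  -- Chosen after the mesh and the orbit integrals `κ j`: the second entry makes the total
  -- contribution of the corrections at most `ε`, while `δ ≤ 1` keeps their sup norms below `C₀ *
  -- η`.
  set δ : ℝ := min 1 (ε / (1 + σ)) with hδ
  have hδ0 : 0 < δ := by positivity
  have hδσ : δ * σ ≤ ε := by
    have h1 : δ * (1 + σ) ≤ ε := by
      rw [← le_div_iff₀ (by positivity)]; exact min_le_right _ _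
    nlinarith
  choose ρ hρF hρi hρs using fun j : ℕ => hlow (φ j) δ hδ0
  have hρs' : ∀ j s, ‖ρ j s‖ ≤ δ * (C₀ * η) := fun j s =>
    (hρs j s).trans (by
      rw [mul_comm C₀, mul_assoc]
      gcongr
      exact hφi j)
  have hρs'' : ∀ j s, ‖ρ j s‖ ≤ C₀ * η := fun j s =>
    (hρs' j s).trans (mul_le_of_le_one_left (by positivity) (min_le_left _ _))
  have hρi' : ∀ j, ∫ s, ‖ρ j s‖ ≤ C₀ * η := fun j =>
    (hρi j).trans (by gcongr; exact hφi j)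
  have hmem : ∀ j ∈ Finset.range N, schwartzTensor (φ j - ρ j) (z j) ∈ homSchwartz Y :=
    fun j _ => schwartzTensor_mem_homSchwartz (hρF j) _
  obtain ⟨hf1, hf2⟩ := sum_schwartzTensor_bounds (E := Y) hη0 hNη
    (by positivity : 0 ≤ C₁ * M * ‖y‖) hφ hb0 hb1 hbs hbup hρs'' hρi' hzK
  have hK : C₁ * M * ‖y‖ * (1 + C₀) = C₁ * M * (1 + C₀) * ‖y‖ := by ring
  rw [hK] at hf1 hf2
  refine ⟨∑ j ∈ Finset.range N, schwartzTensor (φ j - ρ j) (z j), sum_mem_homSchwartz _ hmem,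
    hf1, hf2, fun τ hτ => ?_⟩
  rw [multiplierOp_sum _ fun j hj => h.integrable_resolventPow_fourierHat hα ι (by omega)
    (hmem j hj)]
  set P : ℕ → X := fun j => ∫ s in Ioi (0 : ℝ), φ j (-τ + s) • s ^ n • T s (ι (z j)) with hP
  set Q : ℕ → X := fun j => ∫ s in Ioi (0 : ℝ), ρ j (-τ + s) • s ^ n • T s (ι (z j)) with hQ
  have hPQ : ∀ j, multiplierOp (resolventPow A ι (n + 1)) (schwartzTensor (φ j - ρ j) (z j)) (-τ) =
      ((-1) ^ (n + 1) * (n.factorial : ℝ)⁻¹) • (P j - Q j) := by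
    intro j
    rw [multiplierOp_resolventPow_schwartzTensor hT hA h (hzi j), hP, hQ]
    simp only
    rw [← integral_sub (integrableOn_schwartz_smul _ (hzi j) _)
      (integrableOn_schwartz_smul _ (hzi j) _)]
    simp only [sub_apply, sub_smul]
  simp only [hPQ]
  rw [← Finset.smul_sum, norm_smul, norm_mul, norm_pow, norm_neg, norm_one, one_pow, one_mul,
    Real.norm_of_nonneg (by positivity)]
  refine mul_le_mul_of_nonneg_left ?_ (by positivity)
  rw [Finset.sum_sub_distrib]
  have hQn : ‖∑ j ∈ Finset.range N, Q j‖ ≤ ε := by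
    refine le_trans (norm_sum_le_of_le _ (f := Q) (n := fun j => δ * (C₀ * η * κ j))
      fun j _ => ?_) ?_
    · rw [← mul_assoc, hκ, hQ]
      simp only
      rw [← integral_const_mul]
      refine norm_integral_le_of_norm_le ((hzi j).norm.const_mul _)
        (Eventually.of_forall fun s => ?_)
      rw [norm_smul]
      gcongr
      exact hρs' j _
    · rw [← Finset.mul_sum]
      exact hδσ
  have hτ0 : 0 ≤ τ := by linarith [hτ.1]
  have hu : ∀ u : ℝ, u ≤ τ → τ - η ≤ u → ‖T u x - T τ x‖ ≤ ε := by
    intro u hu1 hu2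
    have hu0 : 0 ≤ u := by linarith [hτ.1]
    have := huc u ⟨hu0, by linarith [hτ.2]⟩ τ ⟨hτ0, hτ.2⟩ (by
      rw [Real.dist_eq, abs_lt]; constructor <;> linarith)
    rw [max_eq_left hu0, max_eq_left hτ0, dist_eq_norm] at this
    exact this.le
  have hW : ∀ j, ∃ W : ℝ, j ∈ Finset.range N →
      (a - 1) ^ n * (η / 2) ≤ W ∧ ‖P j - W • T τ x‖ ≤ ε * W := by
    intro j
    by_cases hj : j ∈ Finset.range N
    · obtain ⟨W, hW⟩ := hT.exists_weight_of_bump hy (a := a - 1) (by linarith) (hj0 j)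
        (by linarith [hjη j hj, hτ.1]) hu (hφ j) (hb0 j) (hbs j) (hblow j)
      refine ⟨W, fun _ => ?_⟩
      rw [hP]
      simp only [hz]
      exact hW
    · exact ⟨0, fun h => absurd h hj⟩
  choose W hW using hW
  set w := ∑ j ∈ Finset.range N, W j with hw
  have hwlow : (a - 1) ^ n / 2 ≤ w := by
    calc (a - 1) ^ n / 2 = ∑ _j ∈ Finset.range N, (a - 1) ^ n * (η / 2) := by
          rw [Finset.sum_const, Finset.card_range, nsmul_eq_mul]
          linear_combination (-(a - 1) ^ n / 2) * hNη
      _ ≤ w := Finset.sum_le_sum fun j hj => (hW j hj).1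
  have hPn : ‖∑ j ∈ Finset.range N, P j - w • T τ x‖ ≤ ε * w := by
    rw [hw, Finset.sum_smul, ← Finset.sum_sub_distrib, Finset.mul_sum]
    exact norm_sum_le_of_le _ fun j hj => (hW j hj).2
  have hpow : 0 ≤ (a - 1) ^ n / 2 := div_nonneg (pow_nonneg (by linarith) _) zero_le_two
  have hPlow : w * (‖T τ x‖ - ε) ≤ ‖∑ j ∈ Finset.range N, P j‖ := by
    have h1 := norm_sub_norm_le (w • T τ x) (∑ j ∈ Finset.range N, P j)
    rw [norm_sub_rev, norm_smul, Real.norm_of_nonneg (hpow.trans hwlow)] at h1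
    linarith
  -- Replacing the total weight `w` by its lower bound needs the other factor to be nonnegative.
  -- Otherwise the claim is trivial.
  have hPlow' : (a - 1) ^ n / 2 * (‖T τ x‖ - ε) ≤ ‖∑ j ∈ Finset.range N, P j‖ := by
    rcases le_total 0 (‖T τ x‖ - ε) with h1 | h1
    · exact (mul_le_mul_of_nonneg_right hwlow h1).trans hPlow
    · exact (mul_nonpos_of_nonneg_of_nonpos hpow h1).trans (norm_nonneg _)
  have := norm_sub_norm_le (∑ j ∈ Finset.range N, P j) (∑ j ∈ Finset.range N, Q j)
  linarith

theorem exists_pow_mul_norm_le (hT : IsC0Semigroup T) {A : X →ₗ.[ℂ] X}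
    (hA : IsGenerator (-A) T) {α β : ℝ} (hα : 0 ≤ α) (h : HasResolventGrowth A α β)
    {ι : Y →L[ℂ] X} {n : ℕ} (hι : IsAdmissible T n ι) (hm : ResolventMultipliers A n ι) :
    ∃ C : ℝ, 0 ≤ C ∧ ∀ y : Y, IntegrableOn (fun s : ℝ => s ^ n • T s (ι y)) (Ioi 0) →
      ∀ a : ℝ, 2 ≤ a → (a - 1) ^ n * ‖T (a + 1) (ι y)‖ ≤ C * ‖y‖ := by
  obtain ⟨ψ, hψ, hψc, p, q, hp, -, hpq, hmul⟩ := hm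
  obtain ⟨hm1, hm2⟩ := hmul (n + 1) (by omega) (by omega) le_rfl
  obtain ⟨D, hD⟩ := exists_le_of_cutoff_multipliers
    (fun f hf => h.integrable_resolventPow_fourierHat hα ι (by omega) hf) hψ.continuous hψc hp hpq
    hm1 hm2
  obtain ⟨C, hC⟩ := exists_test_function hT hA hα h hι
  obtain ⟨M, hM, hMb⟩ := hT.exists_bound 1
  have hM0 : 0 < M := by linarith
  refine ⟨2 * n.factorial * M * (D * C), by positivity, fun y hy a ha => ?_⟩
  -- A lower bound for `‖T τ (ι y)‖` that is uniform over `τ ∈ [a, a + 1]`, because `T (a + 1) = T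
  -- (a + 1 - τ) T τ` and the first factor has norm at most `M`.
  set v := ‖T (a + 1) (ι y)‖ / M with hv
  have hpow : 0 ≤ (a - 1) ^ n / 2 := div_nonneg (pow_nonneg (by linarith) _) zero_le_two
  have key : ∀ ε : ℝ, 0 < ε →
      (n.factorial : ℝ)⁻¹ * ((a - 1) ^ n / 2 * (v - ε) - ε) ≤ D * (C * ‖y‖) := by
    intro ε hε
    obtain ⟨f, hf, hf1, hf2, hf3⟩ := hC y hy a ha ε hε
    have h1 := hD f hf (C * ‖y‖₊) (fun t => by
        rw [← ofReal_norm, ← ENNReal.ofReal_coe_nnreal]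
        exact ENNReal.ofReal_le_ofReal (by simpa using hf1 t))
      (by
        rw [eLpNorm_one_eq_lintegral_enorm, ← ofReal_integral_norm_eq_lintegral_enorm f.integrable,
          ← ENNReal.ofReal_coe_nnreal]
        exact ENNReal.ofReal_le_ofReal (by simpa using hf2))
      a (Real.toNNReal ((n.factorial : ℝ)⁻¹ * ((a - 1) ^ n / 2 * (v - ε) - ε))) (fun τ hτ => by
        rw [← ofReal_norm]
        refine ENNReal.ofReal_le_ofReal (le_trans ?_ (hf3 τ hτ))
        refine mul_le_mul_of_nonneg_left ?_ (by positivity)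
        have h2 : v ≤ ‖T τ (ι y)‖ := by
          rw [hv, div_le_iff₀ hM0, mul_comm]
          have h3 : T (a + 1) (ι y) = T (a + 1 - τ) (T τ (ι y)) := by
            rw [← ContinuousLinearMap.comp_apply (T (a + 1 - τ)), ← hT.map_add (a + 1 - τ) τ
              (by linarith [hτ.2]) (by linarith [hτ.1]), sub_add_cancel]
          rw [h3]
          exact (T _).le_of_opNorm_le (hMb _ ⟨by linarith [hτ.2], by linarith [hτ.1]⟩) _
        have := mul_le_mul_of_nonneg_left (sub_le_sub_right h2 ε) hpow
        linarith)
    have h4 : ((Real.toNNReal ((n.factorial : ℝ)⁻¹ * ((a - 1) ^ n / 2 * (v - ε) - ε)) : ℝ≥0) : ℝ) ≤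
        D * (C * ‖y‖) := by exact_mod_cast h1
    exact (Real.le_coe_toNNReal _).trans h4
  have hlim : Tendsto (fun ε : ℝ => (n.factorial : ℝ)⁻¹ * ((a - 1) ^ n / 2 * (v - ε) - ε))
      (𝓝[>] 0) (𝓝 ((n.factorial : ℝ)⁻¹ * ((a - 1) ^ n / 2 * (v - 0) - 0))) := by
    have : Continuous fun ε : ℝ => (n.factorial : ℝ)⁻¹ * ((a - 1) ^ n / 2 * (v - ε) - ε) := by
      fun_prop
    exact (this.tendsto 0).mono_left nhdsWithin_le_nhds
  have hfin := le_of_tendsto hlim (eventually_nhdsWithin_of_forall key)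
  rw [sub_zero, sub_zero, inv_mul_le_iff₀ (by positivity), hv, div_mul_div_comm,
    div_le_iff₀ (by positivity)] at hfin
  linarith

theorem ResolventMultipliers.polynomiallyStable (hT : IsC0Semigroup T) {A : X →ₗ.[ℂ] X}
    (hA : IsGenerator (-A) T) {α β : ℝ} (hα : 0 ≤ α) (h : HasResolventGrowth A α β)
    {ι : Y →L[ℂ] X} {n : ℕ} (hι : IsAdmissible T n ι) (hm : ResolventMultipliers A n ι) :
    PolynomiallyStable T n ι := by
  obtain ⟨C, hC0, hC⟩ := exists_pow_mul_norm_le hT hA hα h hι hm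
  obtain ⟨M, hM, hMb⟩ := hT.exists_bound 4
  obtain ⟨Y₀, hY₀, hint⟩ := hι.dense
  have hM0 : 0 ≤ M := by linarith
  refine ⟨2 ^ n * C + 4 ^ n * (M * ‖ι‖), ?_⟩
  rintro _ ⟨t, ht, rfl⟩
  have ht0 : 0 ≤ t := ht
  simp only
  rw [norm_smul, norm_pow, Complex.norm_real, Real.norm_of_nonneg ht0]
  -- For `t ≥ 4` the preceding estimate is used with `a = t - 1`, and `t ≤ 2 * (t - 2)` converts its
  -- weight `(t - 2) ^ n` into `t ^ n` at the cost of `2 ^ n`. Both sides are continuous in `y`, so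
  -- the dense subspace suffices.
  rcases le_total t 4 with h4 | h4
  · calc t ^ n * ‖(T t).comp ι‖ ≤ 4 ^ n * (M * ‖ι‖) := by
          gcongr
          exact (ContinuousLinearMap.opNorm_comp_le _ _).trans (by gcongr; exact hMb t ⟨ht0, h4⟩)
      _ ≤ _ := le_add_of_nonneg_left (by positivity)
  · have ht' : 0 < t ^ n := pow_pos (by linarith) n
    have hcl : IsClosed {y : Y | t ^ n * ‖T t (ι y)‖ ≤ 2 ^ n * C * ‖y‖} :=
      isClosed_le (by fun_prop) (by fun_prop)
    have hsub : (Y₀ : Set Y) ⊆ {y : Y | t ^ n * ‖T t (ι y)‖ ≤ 2 ^ n * C * ‖y‖} := by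
      intro y hy
      have h1 := hC y ((hint y hy).mono_set Ioi_subset_Ici_self) (t - 1) (by linarith)
      rw [sub_add_cancel] at h1
      calc t ^ n * ‖T t (ι y)‖ ≤ (2 * (t - 1 - 1)) ^ n * ‖T t (ι y)‖ := by
            gcongr; linarith
        _ = 2 ^ n * ((t - 1 - 1) ^ n * ‖T t (ι y)‖) := by rw [mul_pow]; ring
        _ ≤ 2 ^ n * (C * ‖y‖) := by gcongr
        _ = _ := by ring
    have hall : ∀ y : Y, t ^ n * ‖T t (ι y)‖ ≤ 2 ^ n * C * ‖y‖ := fun y =>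
      hcl.closure_subset_iff.2 hsub (hY₀ y)
    have h2 : ‖(T t).comp ι‖ ≤ 2 ^ n * C / t ^ n := by
      refine ContinuousLinearMap.opNorm_le_bound _ (by positivity) fun y => ?_
      rw [div_mul_eq_mul_div, le_div_iff₀ ht', mul_comm]
      exact hall y
    rw [le_div_iff₀ ht', mul_comm] at h2
    exact h2.trans (le_add_of_nonneg_right (by positivity))

end MultipliersImplyStability

end PolyStab

end

open PolyStab
theorem theorem4p5
    {X : Type*} [NormedAddCommGroup X] [NormedSpace ℂ X] [CompleteSpace X]
    {Y : Type*} [NormedAddCommGroup Y] [NormedSpace ℂ Y] [CompleteSpace Y]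
    (T : ℝ → X →L[ℂ] X) (hT : IsC0Semigroup T)
    (A : X →ₗ.[ℂ] X) (hA : IsGenerator (-A) T)
    (hgrowth : ∃ α β : ℝ, 0 ≤ α ∧ 0 ≤ β ∧ HasResolventGrowth A α β)
    (n : ℕ) (ι : Y →L[ℂ] X) (hι : IsAdmissible T n ι) :
    (PolynomiallyStable T n ι ↔ ResolventMultipliers A n ι) ∧
    (PolynomiallyStable T n ι ∨ ResolventMultipliers A n ι →
      (∀ k : ℕ, 2 ≤ n → 1 ≤ k → k ≤ n - 1 → ∀ p q : ℝ≥0∞, 1 ≤ p → p ≤ q →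
        IsFourierMultiplier p q (resolventPow A ι k)) ∧
      (1 ≤ n → ∀ p q : ℝ≥0∞, 1 ≤ p → p < q →
        IsFourierMultiplier p q (resolventPow A ι n)) ∧
      IsFourierMultiplier 1 ∞ (resolventPow A ι (n + 1))) := by
  obtain ⟨α, β, hα, -, h⟩ := hgrowth
  have h21 : ResolventMultipliers A n ι → PolynomiallyStable T n ι := fun hm =>
    ResolventMultipliers.polynomiallyStable hT hA hα h hι hm
  refine ⟨⟨fun hs => PolynomiallyStable.resolventMultipliers hT hA hα h hs, h21⟩, fun hor => ?_⟩
  have hs : PolynomiallyStable T n ι := hor.elim id h21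
  refine ⟨fun k hn hk hkn p q hp hpq => ?_, fun hn p q hp hpq => ?_, ?_⟩
  · exact PolynomiallyStable.isFourierMultiplier hT hA hα h hs hk (by omega) hp hpq (by omega)
  · exact PolynomiallyStable.isFourierMultiplier hT hA hα h hs hn le_rfl hp hpq.le fun _ => hpq
  · exact PolynomiallyStable.isFourierMultiplier_one_top hT hA hα h hs (by omega) le_rfl
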